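/- Let $k$ be an algebraically closed field of characteristic $0$, let $n>4$ be an even integer, and let $Q$ be a nondegenerate quadratic form on a $k$-vector space of dimension $2n$, with spinor group $\mathbf{Spin}_{2n}=\mathrm{Spin}(Q)$. Let the half-spinor group $\mathbf{Spin}^{1/2}_{2n}\subset \mathrm{GL}(S)$ be the image of $\mathbf{Spin}_{2n}$ under one of its two half-spinor representations $S$, i.e. under the representation given by a simple module $S$ over the even Clifford algebra of $Q$ (the two choices give isomorphic groups). Then the character lattice of $G=\mathbf{Spin}^{1/2}_{2n}$ is not quasi-permutation. Explicitly: let $T$ be a maximal torus of $G$, let $W=N_G(T)/C_G(T)$ be the Weyl group (of type $\mathsf D_n$), and let $\widehat T=\mathrm{Hom}_{\mathrm{alg}}(T,\mathbf G_m)$ be the character group of $T$ with its natural $W$-action. Then there is no exact sequence of $W$-lattices $$0\longrightarrow \widehat T\longrightarrow P\longrightarrow P'\longrightarrow 0$$ in which $P$ and $P'$ are permutation lattices, i.e. $W$-lattices having a finite $\mathbb Z$-basis that is stable under $W$. -/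

import Mathlib

section Lattices

variable {Γ L : Type*} [Group Γ] [AddCommGroup L]

/-- An action `ρ` of `Γ` on an abelian group `L` makes `L` a permutation lattice: `L` has a finite
`ℤ`-basis which is stable under `Γ`. -/
def IsPermutationLattice (ρ : Representation ℤ Γ L) : Prop :=
  ∃ (ι : Type) (_ : Finite ι) (b : Module.Basis ι ℤ L), ∀ (g : Γ) (i : ι), ∃ j : ι, ρ g (b i) = b j

/-- A `Γ`-lattice `L` is quasi-permutation if there is an exact sequence of `Γ`-lattices
`0 → L → P → Q → 0` with `P` and `Q` permutation lattices. -/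
def IsQuasiPermutation (ρ : Representation ℤ Γ L) : Prop :=
  ∃ (P Q : Type) (_ : AddCommGroup P) (_ : AddCommGroup Q)
    (σ : Representation ℤ Γ P) (τ : Representation ℤ Γ Q)
    (i : Representation.IntertwiningMap ρ σ) (p : Representation.IntertwiningMap σ τ),
    IsPermutationLattice σ ∧ IsPermutationLattice τ ∧
      Function.Injective i ∧ Function.Exact i p ∧ Function.Surjective p

end Lattices

section AlgebraicGroups

/-! Linear algebraic groups over an algebraically closed field `k` are viewed as groups of
`k`-points inside the unit group `Aˣ` of a finite-dimensional `k`-algebra `A`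
(`Aˣ = GL(S)` for `A = Module.End k S`, and `Aˣ = (kˣ)^r` for `A = Fin r → k`). -/

variable (k : Type*) [Field k]

/-- The algebra of polynomial functions on a `k`-vector space. -/
def polyFun (E : Type*) [AddCommGroup E] [Module k E] : Subalgebra k (E → k) :=
  Algebra.adjoin k (Set.range fun l : Module.Dual k E => (l : E → k))

variable {k} in
theorem polyFun.comp_mem {E F : Type*} [AddCommGroup E] [Module k E]
    [AddCommGroup F] [Module k F] (f : E →ₗ[k] F) {P : F → k}
    (hP : P ∈ polyFun k F) : P ∘ f ∈ polyFun k E := by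
  induction hP using Algebra.adjoin_induction with
  | mem x hx =>
    obtain ⟨l, rfl⟩ := hx
    exact Algebra.subset_adjoin ⟨l ∘ₗ f, rfl⟩
  | algebraMap r => exact (polyFun k E).algebraMap_mem r
  | add x y _ _ hx hy => exact (polyFun k E).add_mem hx hy
  | mul x y _ _ hx hy => exact (polyFun k E).mul_mem hx hy

variable {A B : Type*} [Ring A] [Algebra k A] [Ring B] [Algebra k B]

/-- Regular functions on a group `G` embedded by `i` in `Aˣ`: restrictions of polynomial functions
in the coordinates of `g` and of `g⁻¹`. -/
def IsRegularFunction {G : Type*} [Group G] (i : G →* Aˣ) (f : G → k) : Prop :=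
  ∃ P ∈ polyFun k (A × A), ∀ g : G, f g = P ((i g : A), ((i g)⁻¹ : Aˣ))

/-- Homomorphisms of algebraic groups `G ⊆ Aˣ`, `H ⊆ Bˣ` (embedded by `i` and `j`): the
group homomorphisms all of whose coordinates are regular functions. -/
def IsAlgebraicHom {G H : Type*} [Group G] [Group H] (i : G →* Aˣ) (j : H →* Bˣ)
    (φ : G →* H) : Prop :=
  ∀ l : Module.Dual k B, IsRegularFunction k i fun g => l (j (φ g) : B)

/-- A subgroup of `Aˣ` is an algebraic torus if it is isomorphic, as an algebraic group,
to some `𝔾ₘʳ`. -/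
def IsTorus (T : Subgroup Aˣ) : Prop :=
  ∃ (r : ℕ) (e : (Fin r → k)ˣ ≃* T),
    IsAlgebraicHom k (MonoidHom.id (Fin r → k)ˣ) T.subtype e.toMonoidHom ∧
    IsAlgebraicHom k T.subtype (MonoidHom.id (Fin r → k)ˣ) e.symm.toMonoidHom

/-- `T` is a maximal torus of the algebraic group `G ⊆ Aˣ`. -/
def IsMaximalTorus (G T : Subgroup Aˣ) : Prop :=
  Maximal (fun T' : Subgroup Aˣ => T' ≤ G ∧ IsTorus k T') T

end AlgebraicGroups

section CharacterLattice

variable {A : Type*} [Ring A]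

/-- The normalizer `N_{G,T} = {g ∈ G | g T g⁻¹ = T}`. -/
def torusNormalizer (G T : Subgroup Aˣ) : Subgroup Aˣ :=
  G ⊓ Subgroup.normalizer (T : Set Aˣ)

/-- The centralizer `C_{G,T} = {g ∈ G | g t g⁻¹ = t for all t ∈ T}`. -/
def torusCentralizer (G T : Subgroup Aˣ) : Subgroup Aˣ :=
  G ⊓ Subgroup.centralizer (T : Set Aˣ)

/-- The conjugation action of the normalizer on `T`. -/
def conjTorus (G T : Subgroup Aˣ) (g : torusNormalizer G T) : T →* T where
  toFun t := ⟨g * t * (g : Aˣ)⁻¹, (Subgroup.mem_normalizer_iff.1 g.2.2 t).1 t.2⟩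
  map_one' := by ext; simp
  map_mul' s t := by
    apply Subtype.ext
    simp [mul_assoc]

instance torusCentralizer_normal (G T : Subgroup Aˣ) :
    ((torusCentralizer G T).subgroupOf (torusNormalizer G T)).Normal where
  conj_mem := by
    rintro ⟨n, hnG, hnT⟩ hn ⟨g, hgG, hgT⟩
    rw [Subgroup.mem_subgroupOf] at hn ⊢
    refine ⟨G.mul_mem (G.mul_mem hgG hnG) (G.inv_mem hgG), ?_⟩
    have hn2 := Subgroup.mem_centralizer_iff.1 hn.2
    refine Subgroup.mem_centralizer_iff.2 fun t ht => ?_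
    have h := hn2 (g⁻¹ * t * g) ((Subgroup.mem_normalizer_iff''.1 hgT t).1 ht)
    simp only [Subgroup.coe_mul, InvMemClass.coe_inv] at h ⊢
    calc t * (g * n * g⁻¹) = g * ((g⁻¹ * t * g) * n) * g⁻¹ := by group
      _ = g * (n * (g⁻¹ * t * g)) * g⁻¹ := by rw [h]
      _ = g * n * g⁻¹ * t := by group

/-- The Weyl group `W_{G,T} = N_{G,T} / C_{G,T}`. -/
abbrev WeylGroup (G T : Subgroup Aˣ) : Type _ :=
  torusNormalizer G T ⧸ (torusCentralizer G T).subgroupOf (torusNormalizer G T)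

variable (k : Type*) [Field k] [Algebra k A]

/-- The character group `Hom_alg(T, 𝔾ₘ)`, written additively. -/
def CharacterLattice (T : Subgroup Aˣ) : AddSubgroup (Additive (T →* kˣ)) where
  carrier := {χ | IsAlgebraicHom k T.subtype (MonoidHom.id kˣ) χ.toMul}
  zero_mem' l := ⟨fun _ => l 1, (polyFun k (A × A)).algebraMap_mem (l 1),
    fun _ => rfl⟩
  add_mem' := by
    intro χ ψ hχ hψ l
    obtain ⟨P, hP, hP'⟩ := hχ LinearMap.id
    obtain ⟨R, hR, hR'⟩ := hψ LinearMap.id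
    refine ⟨(algebraMap k (A × A → k) (l 1)) * (P * R),
      (polyFun k (A × A)).mul_mem
        ((polyFun k (A × A)).algebraMap_mem (l 1))
        ((polyFun k (A × A)).mul_mem hP hR), fun t => ?_⟩
    have h1 := hP' t
    have h2 := hR' t
    simp only [MonoidHom.id_apply, LinearMap.id_apply] at h1 h2
    simp only [Pi.mul_apply, ← h1, ← h2]
    simp
  neg_mem' := by
    intro χ hχ l
    obtain ⟨P, hP, hP'⟩ := hχ l
    refine ⟨P ∘ LinearMap.prod (LinearMap.snd k A A) (LinearMap.fst k A A),
      polyFun.comp_mem _ hP, fun t => ?_⟩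
    have h := hP' t⁻¹
    simpa using h

/-- The action of the normalizer on characters, `(g • χ)(t) = χ(g⁻¹ t g)`. -/
def normalizerRepresentation (G T : Subgroup Aˣ) :
    Representation ℤ (torusNormalizer G T) (CharacterLattice k T) where
  toFun g := AddMonoidHom.toIntLinearMap
    { toFun χ := ⟨Additive.ofMul ((χ : Additive (T →* kˣ)).toMul.comp (conjTorus G T g⁻¹)), by
        intro l
        obtain ⟨P, hP, hP'⟩ := χ.2 l
        let c : A →ₗ[k] A :=
          LinearMap.mulLeft k (((g : Aˣ)⁻¹ : Aˣ) : A) ∘ₗ LinearMap.mulRight k ((g : Aˣ) : A)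
        refine ⟨P ∘ LinearMap.prodMap c c, polyFun.comp_mem _ hP, fun t => ?_⟩
        have h := hP' (conjTorus G T g⁻¹ t)
        simpa [c, conjTorus, mul_assoc] using h⟩
      map_zero' := rfl
      map_add' _ _ := rfl }
  map_one' := by
    ext χ t
    simp [conjTorus]
  map_mul' g h := by
    ext χ t
    simp [conjTorus, mul_assoc]

/-- The character lattice of `G` (with respect to the maximal torus `T`) as a lattice over the
Weyl group: `(gC • χ)(t) = χ(g⁻¹ t g)`. -/
def weylRepresentation (G T : Subgroup Aˣ) :
    Representation ℤ (WeylGroup G T) (CharacterLattice k T) :=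
  QuotientGroup.lift _ (normalizerRepresentation k G T) (by
    intro g hg
    have hg2 := Subgroup.mem_centralizer_iff.1 (Subgroup.mem_subgroupOf.1 hg).2
    ext χ t
    have : conjTorus G T g⁻¹ t = t := by
      apply Subtype.ext
      have := hg2 t t.2
      simp [conjTorus, mul_assoc, this]
    simp [normalizerRepresentation, this])

end CharacterLattice

section HalfSpin

variable {k V : Type*} [Field k] [AddCommGroup V] [Module k V] (Q : QuadraticForm k V)
variable (S : Type*) [AddCommGroup S] [Module k S] [Module (CliffordAlgebra.even Q) S]
  [IsScalarTower k (CliffordAlgebra.even Q) S]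

/-- The representation of `Spin(Q)` on a module `S` over the even Clifford algebra. When
`dim V = 2n`, `Q` is nondegenerate, `k` is algebraically closed and `S` is simple, this is one of
the two half-spin representations. -/
def spinRepresentation : spinGroup Q →* (Module.End k S)ˣ :=
  MonoidHom.toHomUnits
    { toFun x := Algebra.lsmul k k S (⟨x, x.2.2⟩ : CliffordAlgebra.even Q)
      map_one' := map_one (Algebra.lsmul k k S)
      map_mul' x y := map_mul (Algebra.lsmul k k S)
        (⟨x, x.2.2⟩ : CliffordAlgebra.even Q) (⟨y, y.2.2⟩ : CliffordAlgebra.even Q) }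

/-- The half-spin group: the image in `GL(S)` of `Spin(Q)` under the half-spin
representation `S`. -/
def halfSpinGroup : Subgroup (Module.End k S)ˣ :=
  (spinRepresentation Q S).range

end HalfSpin

/-! The obstruction lives on a Klein four-group of sign changes. If `a`, `b` are commuting
involutions, permutation lattices have no H¹, and in their H² over `⟨a, b⟩` a class that dies on
every cyclic subgroup is zero; both facts pass through 0 → L → P → P' → 0 and constrain L. The
explicit form is `IsQuasiPermutation.exists_antiinvariant_difference`: an `x` of norm zero must
satisfy x + abx = l - bl - l' + al' with `l` anti-invariant under `a` and `l'` anti-invariant under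
`b`.

For the half-spinor group, write characters of the torus by their exponents on a cover 𝔾ₘⁿ, chosen
so that the weights of `S` have all exponents ±1. Since changing the sign of any one coordinate of
the cover gives the same element -1 of the spin group, all exponents of a character have the same
parity. Split the coordinates into three nonempty blocks of even size, and let `a`, `b`, `ab` each
invert two of them. Every character has norm zero. An anti-invariant `l` has exponent 0 on the block
fixed by `a`, so all its exponents are even; likewise for `l'`. At a coordinate `r` of the block
inverted by both `a` and `b` the equation reads 2x = 2l - 2l', which is impossible if `x` is a
weight of `S`, with odd exponents. This is `IsHyperbolicBasis.not_isQuasiPermutation`, where parity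
is tested on points having one coordinate a square root of -1.

It remains to see that every maximal torus T has this form
(`IsMaximalTorus.exists_eq_range_halfSpinTorus`). T lies in the algebra generated by s² for some `s`
in T of odd order. A lift of s² acts on V with odd order, hence diagonally in a hyperbolic basis e₁,
…, fₙ, and so commutes with the idempotents eᵢfᵢ. Half-spin representations are not faithful on the
even Clifford algebra, but they are injective on the span of products of two vectors
(`eq_zero_of_map_eq_zero`), so lifts of elements of T commute with every eᵢfᵢ too. The centralizer
of these idempotents in the spin group is the standard torus (`mem_range_spinTorus`), and maximality
of T gives equality. -/

/-! ### Two commuting involutions acting on a permutation lattice, in coordinates -/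

section PermutationLattices

variable {ι : Type*} [LinearOrder ι] {A B : ι → ι}

/-- If `B` exchanges two distinct `A`-orbits, put r + r∘AB on one of them and 0 on the other; the
norm condition makes this `A`-anti-invariant. If `B` preserves an `A`-orbit, the norm condition
reads 2(r i + r (A i)) = 0 there, so `r` itself serves because ℤ is torsion-free. -/
theorem exists_antiinvariant_difference (hA : ∀ i, A (A i) = i) (hB : ∀ i, B (B i) = i)
    (hAB : ∀ i, A (B i) = B (A i)) (r : ι → ℤ)
    (hr : ∀ i, r i + r (A i) + r (B i) + r (A (B i)) = 0) :
    ∃ x : ι → ℤ, (∀ i, x (A i) = -x i) ∧ ∀ i, x i - x (B i) = r i + r (A (B i)) := by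
  -- The minimum of an `A`-orbit is its label: equal labels mean equal orbits, and comparing labels
  -- selects one of two orbits exchanged by `B`.
  have key : ∀ i, min (B i) (A (B i)) = min i (A i) → B i = i ∨ B i = A i := by
    intro i h
    have := hA i; have := hA (B i); have := hAB i
    rcases min_choice (B i) (A (B i)) with h1 | h1 <;>
      rcases min_choice i (A i) with h2 | h2 <;> grind
  refine ⟨fun i => if min i (A i) < min (B i) (A (B i)) then r i + r (A (B i))
    else if min (B i) (A (B i)) = min i (A i) then r i else 0, fun i => ?_, fun i => ?_⟩
  · have e1 : min (A i) (A (A i)) = min i (A i) := by rw [hA, min_comm]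
    have e2 : min (B (A i)) (A (B (A i))) = min (B i) (A (B i)) := by
      rw [← hAB, hA, min_comm]
    have := hr i
    simp only [e1, e2]
    split_ifs with h1 h2
    · rw [← hAB, hA]; linarith
    · rcases key i h2 with h | h
      · rw [h] at this; linarith
      · rw [h, hA] at this; linarith
    · simp
  · have := hr i
    simp only [hB]
    rcases lt_trichotomy (min i (A i)) (min (B i) (A (B i))) with h | h | h
    · rw [if_pos h, if_neg h.not_gt, if_neg h.ne]; simp
    · rw [if_neg h.not_lt, if_pos h.symm, if_neg h.not_gt, if_pos h]
      rcases key i h.symm with h | h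
      · rw [h] at this ⊢; linarith
      · rw [h, hA] at this ⊢; linarith
    · rw [if_neg h.not_gt, if_neg h.ne, if_pos h]; linarith

/-- The vanishing of H¹ for permutation modules in explicit form: keep `x` on one of each two
`B`-orbits exchanged by `A`, and 0 on the other. Where `A` preserves a `B`-orbit, x = -x forces x =
0. -/
theorem exists_invariant_difference (hA : ∀ i, A (A i) = i) (hB : ∀ i, B (B i) = i)
    (hAB : ∀ i, A (B i) = B (A i)) (x : ι → ℤ)
    (hxA : ∀ i, x (A i) = -x i) (hxB : ∀ i, x (B i) = x i) :
    ∃ w : ι → ℤ, (∀ i, w (B i) = w i) ∧ ∀ i, w i - w (A i) = x i := by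
  have key : ∀ i, min (A i) (B (A i)) = min i (B i) → A i = i ∨ A i = B i := by
    intro i h
    have := hB i; have := hB (A i); have := hAB i
    rcases min_choice (A i) (B (A i)) with h1 | h1 <;>
      rcases min_choice i (B i) with h2 | h2 <;> grind
  refine ⟨fun i => if min i (B i) < min (A i) (B (A i)) then x i else 0,
    fun i => ?_, fun i => ?_⟩
  · have e1 : min (B i) (B (B i)) = min i (B i) := by rw [hB, min_comm]
    have e2 : min (A (B i)) (B (A (B i))) = min (A i) (B (A i)) := by
      rw [hAB, hB, min_comm]
    simp only [e1, e2, hxB]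
  · simp only [hA, hxA]
    rcases lt_trichotomy (min i (B i)) (min (A i) (B (A i))) with h | h | h
    · rw [if_pos h, if_neg h.not_gt]; simp
    · rw [if_neg h.not_lt, if_neg h.not_gt]
      rcases key i h.symm with h | h
      · have := hxA i; rw [h] at this; linarith
      · have := hxA i; rw [h, hxB] at this; linarith
    · rw [if_neg h.not_gt, if_pos h]; simp

end PermutationLattices

/-! ### The obstruction for quasi-permutation lattices -/

section QuasiPermutation

variable {Γ L : Type*} [Group Γ] [AddCommGroup L] {ρ : Representation ℤ Γ L}

/-- In coordinates a group element acts through the inverse permutation of the basis; for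
involutions the inverse disappears. -/
theorem IsPermutationLattice.exists_coordinates (h : IsPermutationLattice ρ) {a b : Γ}
    (ha : a * a = 1) (hb : b * b = 1) (hab : a * b = b * a) :
    ∃ (n : ℕ) (e : L ≃ₗ[ℤ] (Fin n → ℤ)) (A B : Fin n → Fin n),
      (∀ i, A (A i) = i) ∧ (∀ i, B (B i) = i) ∧ (∀ i, A (B i) = B (A i)) ∧
      (∀ x i, e (ρ a x) i = e x (A i)) ∧ (∀ x i, e (ρ b x) i = e x (B i)) := by
  obtain ⟨κ, hκ, β, hβ⟩ := h
  obtain ⟨n, ⟨f⟩⟩ := Finite.exists_equiv_fin κ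
  let β' := β.reindex f
  have hβ' : ∀ (g : Γ) (i : Fin n), ∃ j, ρ g (β' i) = β' j := by
    intro g i
    obtain ⟨j, hj⟩ := hβ g (f.symm i)
    exact ⟨f j, by simp [β', hj]⟩
  choose p hp using hβ'
  have hmul : ∀ g g' i, p g (p g' i) = p (g * g') i := by
    intro g g' i
    apply β'.injective
    rw [← hp, ← hp, ← hp, map_mul]; rfl
  have hone : ∀ i, p 1 i = i := by
    intro i
    apply β'.injective
    rw [← hp, map_one]; rfl
  have hcoord : ∀ g, g * g = 1 → ∀ x i, β'.equivFun (ρ g x) i = β'.equivFun x (p g i) := by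
    intro g hg x i
    have : (LinearMap.proj i ∘ₗ β'.equivFun.toLinearMap ∘ₗ (ρ g)) =
        LinearMap.proj (p g i) ∘ₗ β'.equivFun.toLinearMap := by
      refine β'.ext fun j => ?_
      simp only [LinearMap.comp_apply, hp, LinearEquiv.coe_coe, Module.Basis.equivFun_self,
        LinearMap.proj_apply]
      have : p g j = i ↔ j = p g i := by
        constructor
        · rintro rfl; rw [hmul, hg, hone]
        · rintro rfl; rw [hmul, hg, hone]
      simp [this]
    exact LinearMap.congr_fun this x
  refine ⟨n, β'.equivFun, p a, p b, fun i => ?_, fun i => ?_, fun i => ?_,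
    hcoord a ha, hcoord b hb⟩
  · rw [hmul, ha, hone]
  · rw [hmul, hb, hone]
  · rw [hmul, hmul, hab]

/-- The obstruction to being quasi-permutation: for commuting involutions `a`, `b`, the classes in
`H²(⟨a, b⟩, L)` with trivial restriction to `⟨a⟩`, `⟨b⟩` and `⟨ab⟩` are trivial. -/
theorem IsQuasiPermutation.exists_antiinvariant_difference (h : IsQuasiPermutation ρ) {a b : Γ}
    (ha : a * a = 1) (hb : b * b = 1) (hab : a * b = b * a) (x : L)
    (hx : x + ρ a x + ρ b x + ρ a (ρ b x) = 0) :
    ∃ l l' : L, ρ a l = -l ∧ ρ b l' = -l' ∧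
      l - ρ b l - l' + ρ a l' = x + ρ a (ρ b x) := by
  obtain ⟨P, R, _, _, σ, τ, i, p, hσ, hτ, hi, hip, hp⟩ := h
  obtain ⟨m, e, A, B, hA, hB, hAB, hea, heb⟩ := hσ.exists_coordinates ha hb hab
  obtain ⟨m', e', A', B', hA', hB', hAB', hea', heb'⟩ := hτ.exists_coordinates ha hb hab
  have iρ : ∀ g y, i (ρ g y) = σ g (i y) := fun g y => Representation.IntertwiningMap.isIntertwining _ _ i g y
  have pσ : ∀ g y, p (σ g y) = τ g (p y) := fun g y => Representation.IntertwiningMap.isIntertwining _ _ p g y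
  have pi0 : ∀ y, p (i y) = 0 := fun y => (hip _).2 ⟨y, rfl⟩
  have hx' : ∀ j, e (i x) j + e (i x) (A j) + e (i x) (B j) + e (i x) (A (B j)) = 0 := by
    intro j
    have := congrArg (fun y => e (i y) j) hx
    simpa [iρ, hea, heb, hAB] using this
  -- Solve the problem in P with l' = 0. The solution `y` need not lie in L; its image in the
  -- quotient measures the failure.
  obtain ⟨y, hyA, hyB⟩ := _root_.exists_antiinvariant_difference hA hB hAB (e (i x)) hx'
  obtain ⟨y, rfl⟩ := e.surjective y
  have hya : σ a y = -y := e.injective (funext fun j => by simp [hea, hyA])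
  have hyb : y - σ b y = i (x + ρ a (ρ b x)) := e.injective (funext fun j => by
    simp [hea, heb, hyB, iρ, hAB])
  have hpa : τ a (p y) = -p y := by rw [← pσ, hya, map_neg]
  have hpb : τ b (p y) = p y := by
    have := congrArg p hyb
    rw [pi0, map_sub, pσ] at this
    exact (sub_eq_zero.1 this).symm
  -- The image of `y` is `a`-anti-invariant and `b`-invariant, hence of the form w - aw with `w`
  -- fixed by `b`.
  obtain ⟨w, hwB, hwA⟩ := exists_invariant_difference hA' hB' hAB' (e' (p y))
    (fun j => by rw [← hea', hpa]; simp) (fun j => by rw [← heb', hpb])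
  obtain ⟨w, rfl⟩ := e'.surjective w
  obtain ⟨w, rfl⟩ := hp w
  have hwb : τ b (p w) = p w := e'.injective (funext fun j => by rw [heb', hwB])
  have hwa : p w - τ a (p w) = p y := e'.injective (funext fun j => by simp [hea', hwA])
  -- With `w` lifted to P, both y - (w - aw) and -(w - bw) map to zero, so they come from L. The
  -- contributions of `w` to the required identity cancel because `a` and `b` commute.
  obtain ⟨l, hl⟩ := (hip (y - (w - σ a w))).1 (by
    rw [map_sub, map_sub, pσ, hwa, sub_self])
  obtain ⟨l', hl'⟩ := (hip (-(w - σ b w))).1 (by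
    rw [map_neg, map_sub, pσ, hwb, sub_self, neg_zero])
  have hinv : ∀ g, g * g = 1 → ∀ z, σ g (σ g z) = z := by
    intro g hg z
    have := congrArg (fun f => f z) (map_mul σ g g)
    rw [hg, map_one] at this
    exact this.symm
  have hcomm : ∀ z, σ a (σ b z) = σ b (σ a z) := by
    intro z
    have := congrArg (fun g => σ g z) hab
    simpa using this
  refine ⟨l, l', hi ?_, hi ?_, hi ?_⟩
  · rw [iρ, hl, map_neg, hl]; simp only [map_sub, hya, hinv a ha]; abel
  · simp only [iρ, hl', map_neg, map_sub, hinv b hb]; abel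
  · rw [← hyb]
    simp only [map_add, map_sub, iρ, hl, hl', map_neg, hcomm]
    abel

end QuasiPermutation

/-! ### The algebra of regular functions -/

section RegularFunctions

variable (k : Type*) [Field k] {A G : Type*} [Ring A] [Algebra k A] [Group G]

/-- The algebra of regular functions on a group embedded in `Aˣ`. -/
def regularFunctions (i : G →* Aˣ) : Subalgebra k (G → k) where
  carrier := {f | IsRegularFunction k i f}
  mul_mem' := by
    rintro f g ⟨P, hP, hf⟩ ⟨R, hR, hg⟩
    exact ⟨P * R, mul_mem hP hR, fun x => by simp [hf, hg]⟩
  add_mem' := by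
    rintro f g ⟨P, hP, hf⟩ ⟨R, hR, hg⟩
    exact ⟨P + R, add_mem hP hR, fun x => by simp [hf, hg]⟩
  algebraMap_mem' c := ⟨algebraMap k _ c, Subalgebra.algebraMap_mem _ c, fun _ => rfl⟩

variable {k}

theorem mem_regularFunctions {i : G →* Aˣ} {f : G → k} :
    f ∈ regularFunctions k i ↔ IsRegularFunction k i f := Iff.rfl

theorem dual_mem_regularFunctions (i : G →* Aˣ) (l : Module.Dual k A) :
    (fun g => l (i g : A)) ∈ regularFunctions k i :=
  ⟨(l : A → k) ∘ LinearMap.fst k A A,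
    polyFun.comp_mem _ (Algebra.subset_adjoin ⟨l, rfl⟩), fun _ => rfl⟩

theorem dual_inv_mem_regularFunctions (i : G →* Aˣ) (l : Module.Dual k A) :
    (fun g => l (((i g)⁻¹ : Aˣ) : A)) ∈ regularFunctions k i :=
  ⟨(l : A → k) ∘ LinearMap.snd k A A,
    polyFun.comp_mem _ (Algebra.subset_adjoin ⟨l, rfl⟩), fun _ => rfl⟩

theorem regularFunctions_le_of_dual_mem (i : G →* Aˣ) (R : Subalgebra k (G → k))
    (h : ∀ l : Module.Dual k A, (fun g => l (i g : A)) ∈ R)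
    (h' : ∀ l : Module.Dual k A, (fun g => l (((i g)⁻¹ : Aˣ) : A)) ∈ R) :
    regularFunctions k i ≤ R := by
  rintro f ⟨P, hP, hf⟩
  obtain rfl : f = fun g => P ((i g : A), ((i g)⁻¹ : Aˣ)) := funext hf
  clear hf
  induction hP using Algebra.adjoin_induction with
  | mem x hx =>
    obtain ⟨l, rfl⟩ := hx
    have : (fun g => l ((i g : A), (((i g)⁻¹ : Aˣ) : A))) =
        (fun g => (l ∘ₗ LinearMap.inl k A A) (i g : A)) +
        fun g => (l ∘ₗ LinearMap.inr k A A) (((i g)⁻¹ : Aˣ) : A) := by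
      funext g
      simp only [Pi.add_apply, LinearMap.comp_apply, ← map_add]
      simp
    rw [this]
    exact add_mem (h _) (h' _)
  | algebraMap r => exact R.algebraMap_mem r
  | add x y _ _ hx hy => exact add_mem hx hy
  | mul x y _ _ hx hy => exact mul_mem hx hy

end RegularFunctions

/-! ### Monomial characters of 𝔾ₘʳ and torsion elements generating a torus -/

section MonomialCharacters

variable {k : Type*} [Field k] {r : ℕ}

/-- The coordinate characters of `𝔾ₘʳ`. -/
def coordChar (j : Fin r) : (Fin r → k)ˣ →* kˣ := Units.map (Pi.evalMonoidHom (fun _ => k) j)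

@[simp]
theorem coordChar_val (j : Fin r) (t : (Fin r → k)ˣ) :
    (coordChar j t : k) = (t : Fin r → k) j := rfl

/-- The character `t ↦ ∏ tⱼ ^ αⱼ` of `𝔾ₘʳ`. -/
def monomialChar (α : Fin r → ℤ) : (Fin r → k)ˣ →* kˣ := ∏ j, coordChar j ^ α j

theorem monomialChar_apply (α : Fin r → ℤ) (t : (Fin r → k)ˣ) :
    monomialChar α t = ∏ j, coordChar j t ^ α j := by
  simp [monomialChar, MonoidHom.finsetProd_apply]

theorem monomialChar_add (α β : Fin r → ℤ) :
    (monomialChar (α + β) : (Fin r → k)ˣ →* kˣ) = monomialChar α * monomialChar β := by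
  ext1 t
  simp only [monomialChar_apply, MonoidHom.mul_apply, Pi.add_apply, zpow_add,
    Finset.prod_mul_distrib]

@[simp]
theorem monomialChar_zero : (monomialChar 0 : (Fin r → k)ˣ →* kˣ) = 1 := by
  ext1 t
  simp [monomialChar_apply]

theorem monomialChar_single (j : Fin r) :
    (monomialChar (Pi.single j 1) : (Fin r → k)ˣ →* kˣ) = coordChar j := by
  ext1 t
  rw [monomialChar_apply, Finset.prod_eq_single j] <;> simp +contextual

/-- Monomial characters as a homomorphism from the lattice `ℤʳ`. -/
def monomialCharHom : (Fin r → ℤ) →+ Additive ((Fin r → k)ˣ →* kˣ) where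
  toFun α := Additive.ofMul (monomialChar α)
  map_zero' := by simp
  map_add' α β := by rw [monomialChar_add]; rfl

theorem monomialChar_sum {ι : Type*} (s : Finset ι) (c : ι → ℤ) (α : ι → Fin r → ℤ) :
    (monomialChar (∑ i ∈ s, c i • α i) : (Fin r → k)ˣ →* kˣ) =
      ∏ i ∈ s, monomialChar (α i) ^ c i := by
  have := map_sum (monomialCharHom (k := k) (r := r)) (fun i => c i • α i) s
  simp only [map_zsmul] at this
  exact this

/-- The units of `kʳ` with given invertible coordinates. -/
def unitsOfCoords (u : Fin r → kˣ) : (Fin r → k)ˣ := MulEquiv.piUnits.symm u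

@[simp]
theorem coordChar_unitsOfCoords (u : Fin r → kˣ) (j : Fin r) :
    coordChar j (unitsOfCoords u) = u j := rfl

theorem unitsOfCoords_coordChar (t : (Fin r → k)ˣ) :
    unitsOfCoords (fun j => coordChar j t) = t := rfl

theorem dual_apply_eq_sum_coordChar (l : Module.Dual k (Fin r → k)) (t : (Fin r → k)ˣ) :
    l (t : Fin r → k) = ∑ j, l (Pi.single j 1) * (coordChar j t : k) := by
  conv_lhs => rw [← Finset.univ_sum_single (t : Fin r → k)]
  rw [map_sum]
  refine Finset.sum_congr rfl fun j _ => ?_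
  have : (Pi.single j ((t : Fin r → k) j) : Fin r → k) =
      (t : Fin r → k) j • Pi.single j 1 := by
    rw [← Pi.single_smul]; simp
  rw [this, map_smul, coordChar_val, smul_eq_mul, mul_comm]

/-- Regular functions on `𝔾ₘʳ` are Laurent polynomials. -/
theorem regularFunctions_le_span_monomialChar :
    Subalgebra.toSubmodule (regularFunctions k (MonoidHom.id (Fin r → k)ˣ)) ≤
      Submodule.span k (Set.range fun (α : Fin r → ℤ) (t : (Fin r → k)ˣ) =>
        (monomialChar α t : k)) := by
  set X : Set ((Fin r → k)ˣ → k) := Set.range fun (α : Fin r → ℤ) (t : (Fin r → k)ˣ) =>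
        (monomialChar α t : k) with hX
  -- The monomials are closed under multiplication, so their linear span is already the algebra they
  -- generate.
  have hcl : ((Submonoid.closure X : Set ((Fin r → k)ˣ → k))) ⊆ (Submodule.span k X : Set _) := by
    intro f hf
    suffices f ∈ X from Submodule.subset_span this
    induction hf using Submonoid.closure_induction with
    | mem x hx => exact hx
    | one => exact ⟨0, by simp; rfl⟩
    | mul x y _ _ hx hy =>
      obtain ⟨α, rfl⟩ := hx
      obtain ⟨β, rfl⟩ := hy
      exact ⟨α + β, by funext t; simp [monomialChar_add]⟩
  rw [← Algebra.adjoin_eq_span_of_subset k hcl]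
  refine regularFunctions_le_of_dual_mem _ _ (fun l => ?_) (fun l => ?_)
  · simp only [MonoidHom.id_apply, dual_apply_eq_sum_coordChar]
    have : (fun t : (Fin r → k)ˣ => ∑ j, l (Pi.single j 1) * (coordChar j t : k)) =
        ∑ j, l (Pi.single j 1) • fun t : (Fin r → k)ˣ => (monomialChar (Pi.single j 1) t : k) := by
      funext t; simp [monomialChar_single]
    rw [this]
    exact sum_mem fun j _ => Subalgebra.smul_mem _ (Algebra.subset_adjoin (Set.mem_range_self _)) _
  · simp only [MonoidHom.id_apply, dual_apply_eq_sum_coordChar]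
    have : (fun t : (Fin r → k)ˣ => ∑ j, l (Pi.single j 1) * (coordChar j t⁻¹ : k)) =
        ∑ j, l (Pi.single j 1) •
          fun t : (Fin r → k)ˣ => (monomialChar (-Pi.single j 1) t : k) := by
      funext t
      simp only [Finset.sum_apply, Pi.smul_apply, smul_eq_mul]
      refine Finset.sum_congr rfl fun j _ => ?_
      have h := congrArg (fun f => f t) (monomialChar_add (k := k) (-Pi.single j 1) (Pi.single j 1))
      simp only [neg_add_cancel, monomialChar_zero, monomialChar_single, MonoidHom.one_apply,
        MonoidHom.mul_apply] at h
      rw [eq_inv_of_mul_eq_one_left h.symm, map_inv]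
    rw [this]
    exact sum_mem fun j _ => Subalgebra.smul_mem _ (Algebra.subset_adjoin (Set.mem_range_self _)) _

theorem monomialChar_mem_regularFunctions (α : Fin r → ℤ) :
    (fun t : (Fin r → k)ˣ => (monomialChar α t : k)) ∈
      regularFunctions k (MonoidHom.id (Fin r → k)ˣ) := by
  have h1 : ∀ j (z : ℤ), (fun t : (Fin r → k)ˣ => ((coordChar j t ^ z : kˣ) : k)) ∈
      regularFunctions k (MonoidHom.id (Fin r → k)ˣ) := by
    intro j z
    have hz : ∀ n : ℕ, (fun t : (Fin r → k)ˣ => ((coordChar j t ^ (n : ℤ) : kˣ) : k)) ∈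
        regularFunctions k (MonoidHom.id (Fin r → k)ˣ) := fun n => by
      have := pow_mem (dual_mem_regularFunctions (MonoidHom.id (Fin r → k)ˣ)
        (LinearMap.proj j)) n
      convert this using 1
      funext t; simp
    rcases Int.eq_nat_or_neg z with ⟨n, rfl | rfl⟩
    · exact hz n
    · have := pow_mem (dual_inv_mem_regularFunctions (MonoidHom.id (Fin r → k)ˣ)
        (LinearMap.proj j)) n
      convert this using 1
      funext t
      have : ((t⁻¹ : (Fin r → k)ˣ) : Fin r → k) j = ((coordChar j t)⁻¹ : kˣ) := by
        rw [← map_inv]; rfl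
      simp
  have := prod_mem (S := regularFunctions k (MonoidHom.id (Fin r → k)ˣ))
    (t := Finset.univ) fun j _ => h1 j (α j)
  convert this using 1
  funext t
  simp [monomialChar_apply]

variable {A : Type*} [Ring A] [Algebra k A]

/-- A polynomial representation of `𝔾ₘʳ` is a combination of monomial characters. -/
theorem exists_weight_expansion [FiniteDimensional k A] (f : (Fin r → k)ˣ → A)
    (hf : ∀ l : Module.Dual k A,
      IsRegularFunction k (MonoidHom.id (Fin r → k)ˣ) fun t => l (f t)) :
    ∃ (X : Finset (Fin r → ℤ)) (E : (Fin r → ℤ) → A),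
      ∀ t, f t = ∑ α ∈ X, (monomialChar α t : k) • E α := by
  classical
  let b := Module.finBasis k A
  have h : ∀ i, ∃ c : (Fin r → ℤ) →₀ k,
      (c.sum fun α a => a • fun t : (Fin r → k)ˣ => (monomialChar α t : k)) =
        fun t => b.coord i (f t) := by
    intro i
    have := regularFunctions_le_span_monomialChar (mem_regularFunctions.2 (hf (b.coord i)))
    exact Finsupp.mem_span_range_iff_exists_finsupp.1 this
  choose c hc using h
  refine ⟨Finset.univ.biUnion fun i => (c i).support, fun α => ∑ i, c i α • b i, fun t => ?_⟩
  rw [← b.sum_repr (f t)]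
  simp only [Finset.smul_sum]
  rw [Finset.sum_comm]
  refine Finset.sum_congr rfl fun i _ => ?_
  have h1 := congrFun (hc i) t
  have h2 : b.repr (f t) i = b.coord i (f t) := rfl
  rw [h2, ← h1, Finsupp.sum, Finset.sum_apply, Finset.sum_smul]
  rw [Finset.sum_subset (Finset.subset_biUnion_of_mem (fun i => (c i).support)
    (Finset.mem_univ i))]
  · refine Finset.sum_congr rfl fun α _ => ?_
    simp [smul_smul, mul_comm]
  · intro α _ hα
    simp [Finsupp.notMem_support_iff.1 hα]

/-- Finitely many nonzero rational vectors are avoided by the kernel of some linear functional;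
clearing its denominators gives a one-parameter subgroup on which the given characters stay
distinct. -/
theorem exists_int_separating (X : Finset (Fin r → ℤ)) :
    ∃ a : Fin r → ℤ, ∀ α ∈ X, ∀ β ∈ X, ∑ j, α j * a j = ∑ j, β j * a j → α = β := by
  classical
  let ι := {p : X × X // p.1.1 ≠ p.2.1}
  let v : ι → (Fin r → ℚ) := fun p j => ((p.1.1.1 j - p.1.2.1 j : ℤ) : ℚ)
  obtain ⟨f, hf⟩ := Module.exists_dual_forall_apply_ne_zero (K := ℚ) v fun p h => p.2 (by
    funext j
    have := congrFun h j
    simp only [v, Pi.zero_apply, Int.cast_eq_zero] at this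
    linarith)
  let q : Fin r → ℚ := fun j => f (Pi.single j 1)
  let D : ℤ := ∏ j, ((q j).den : ℤ)
  have hD : (D : ℚ) ≠ 0 := by
    simp only [D]; push_cast
    exact Finset.prod_ne_zero_iff.2 fun j _ => by simp
  have hz : ∀ j, ∃ z : ℤ, (z : ℚ) = D * q j := by
    intro j
    refine ⟨(∏ i ∈ Finset.univ.erase j, ((q i).den : ℤ)) * (q j).num, ?_⟩
    have : D = (∏ i ∈ Finset.univ.erase j, ((q i).den : ℤ)) * (q j).den :=
      (Finset.prod_erase_mul _ _ (Finset.mem_univ j)).symm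
    rw [this]
    push_cast
    rw [mul_assoc, mul_comm ((q j).den : ℚ), Rat.mul_den_eq_num]
  choose a ha using hz
  refine ⟨a, fun α hα β hβ h => by_contra fun hne => hf ⟨(⟨α, hα⟩, ⟨β, hβ⟩), hne⟩ ?_⟩
  rw [← Finset.univ_sum_single (v _), map_sum]
  have h1 : ∀ j, f (Pi.single j (v ⟨(⟨α, hα⟩, ⟨β, hβ⟩), hne⟩ j)) = ((α j - β j : ℤ) : ℚ) * q j := by
    intro j
    have : (Pi.single j (v ⟨(⟨α, hα⟩, ⟨β, hβ⟩), hne⟩ j) : Fin r → ℚ) =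
        ((α j - β j : ℤ) : ℚ) • Pi.single j 1 := by
      rw [← Pi.single_smul]; simp [v]
    rw [this, map_smul, smul_eq_mul]
  simp only [h1]
  have h2 : (∑ j, (α j - β j) * a j : ℤ) = 0 := by
    simp only [sub_mul, Finset.sum_sub_distrib, h, sub_self]
  have h3 : (D : ℚ) * ∑ j, ((α j - β j : ℤ) : ℚ) * q j = 0 := by
    rw [Finset.mul_sum, ← Int.cast_zero, ← h2]
    push_cast
    refine Finset.sum_congr rfl fun j _ => ?_
    rw [ha]; ring
  exact (mul_eq_zero.1 h3).resolve_left hD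

/-- There are torsion points of odd order of `𝔾ₘʳ` whose squares separate a given finite set of
characters. -/
theorem exists_odd_torsion_separating [IsAlgClosed k] [CharZero k] (X : Finset (Fin r → ℤ)) :
    ∃ (m : ℕ) (s : (Fin r → k)ˣ), Odd m ∧ s ^ m = 1 ∧
      Set.InjOn (fun α => (monomialChar α (s ^ 2) : k)) (X : Set (Fin r → ℤ)) := by
  obtain ⟨a, ha⟩ := exists_int_separating X
  let c : (Fin r → ℤ) → ℤ := fun α => ∑ j, α j * a j
  -- Two exponents `c α`, `c β` differ by at most 2M in absolute value, so a root of unity of the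
  -- odd order 2M + 1 still separates them.
  let M : ℕ := ∑ α ∈ X, (c α).natAbs
  have hM : ∀ α ∈ X, (c α).natAbs ≤ M := fun α hα =>
    Finset.single_le_sum (f := fun α => (c α).natAbs) (fun _ _ => Nat.zero_le _) hα
  have : NeZero ((2 * M + 1 : ℕ) : k) := ⟨Nat.cast_ne_zero.2 (Nat.succ_ne_zero _)⟩
  obtain ⟨ζ, hζ⟩ := IsAlgClosed.exists_root (Polynomial.cyclotomic (2 * M + 1) k)
    (Polynomial.degree_cyclotomic_pos _ _ (Nat.succ_pos _)).ne'
  rw [Polynomial.isRoot_cyclotomic_iff] at hζ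
  have hζu := hζ.isUnit_unit (Nat.succ_ne_zero _)
  set u := (hζ.isUnit (Nat.succ_ne_zero _)).unit
  let s : (Fin r → k)ˣ := unitsOfCoords fun j => u ^ a j
  have hs : ∀ α, monomialChar α s = u ^ c α := by
    intro α
    simp only [monomialChar_apply, s, coordChar_unitsOfCoords, c]
    rw [Finset.prod_congr rfl fun j _ => show (u ^ a j) ^ α j = u ^ (α j * a j) by
      rw [← zpow_mul, mul_comm]]
    exact (map_sum (zmultiplesHom (Additive kˣ) (Additive.ofMul u)) (fun j => α j * a j) Finset.univ).symm
  refine ⟨2 * M + 1, s, ⟨M, rfl⟩, ?_, ?_⟩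
  · rw [← unitsOfCoords_coordChar (s ^ _)]
    have : ∀ j, coordChar j (s ^ (2 * M + 1)) = 1 := by
      intro j
      simp only [s, map_pow, coordChar_unitsOfCoords]
      rw [← zpow_natCast, ← zpow_mul, mul_comm, zpow_mul, zpow_natCast, hζu.pow_eq_one, one_zpow]
    simp only [this]; rfl
  · intro α hα β hβ h
    simp only [map_pow, hs, Units.val_inj] at h
    have h1 : u ^ (2 * (c α - c β)) = 1 := by
      rw [mul_sub, zpow_sub, mul_inv_eq_one, mul_comm 2, mul_comm 2, zpow_mul, zpow_mul]
      exact_mod_cast h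
    rw [hζu.zpow_eq_one_iff_dvd] at h1
    -- The order is odd, so squaring loses nothing: 1 · (2M + 1) - M · 2 = 1.
    have h2 : ((2 * M + 1 : ℕ) : ℤ) ∣ c α - c β :=
      IsCoprime.dvd_of_dvd_mul_left ⟨1, -M, by push_cast; ring⟩ h1
    refine ha α hα β hβ (sub_eq_zero.1 (Int.eq_zero_of_abs_lt_dvd h2 ?_))
    have := hM α hα
    have := hM β hβ
    change |c α - c β| < _
    push_cast
    rw [abs_lt]
    omega

/-- A torus is contained in the algebra generated by the square of one of its elements of
finite odd order. -/
theorem IsTorus.exists_odd_torsion_generator [IsAlgClosed k] [CharZero k] [FiniteDimensional k A]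
    {T : Subgroup Aˣ} (hT : IsTorus k T) :
    ∃ (m : ℕ) (s : Aˣ), Odd m ∧ s ∈ T ∧ s ^ m = 1 ∧
      ∀ t ∈ T, (t : A) ∈ Algebra.adjoin k {(s : A) ^ 2} := by
  classical
  obtain ⟨r, e, he, -⟩ := hT
  obtain ⟨X, E, hE⟩ := exists_weight_expansion (fun t => ((e t : Aˣ) : A)) he
  obtain ⟨m, s, hm, hs, hinj⟩ := exists_odd_torsion_separating (k := k) X
  refine ⟨m, e s, hm, (e s).2, ?_, fun t ht => ?_⟩
  · rw [← Subgroup.coe_pow, ← map_pow, hs, map_one, Subgroup.coe_one]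
  · obtain ⟨t, rfl⟩ : ∃ t', t = e t' := ⟨e.symm ⟨t, ht⟩, by simp⟩
    rw [hE t]
    refine Subalgebra.sum_mem _ fun α hα => ?_
    refine Subalgebra.smul_mem _ ?_ _
    let z : (Fin r → ℤ) → k := fun α => (monomialChar α (s ^ 2) : k)
    -- The powers of s² are combinations of the `E β` with coefficients the powers of the distinct
    -- values `z β`; Lagrange interpolation at these values isolates `E α` as a polynomial in s².
    let p := Lagrange.basis X z α
    have hpow : ∀ j : ℕ, (((e s : Aˣ) : A) ^ 2) ^ j = ∑ β ∈ X, z β ^ j • E β := by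
      intro j
      have := hE ((s ^ 2) ^ j)
      simpa [z] using this
    have : E α = Polynomial.aeval (((e s : Aˣ) : A) ^ 2) p := by
      rw [Polynomial.aeval_eq_sum_range]
      simp only [hpow, Finset.smul_sum, smul_smul]
      rw [Finset.sum_comm]
      simp only [← Finset.sum_smul, ← Polynomial.eval_eq_sum_range]
      rw [Finset.sum_eq_single_of_mem α hα]
      · rw [Lagrange.eval_basis_self hinj hα, one_smul]
      · intro β hβ hne
        rw [Lagrange.eval_basis_of_ne hne.symm hβ, zero_smul]
    rw [this]
    exact Polynomial.aeval_mem_adjoin_singleton _ _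

end MonomialCharacters

/-! ### Images of diagonal representations are tori -/

section ImageTorus

variable {k : Type*} [Field k] {A : Type*} [Ring A] [Algebra k A]
variable {ι : Type*} [Fintype ι]

/-- The diagonal representation `g ↦ ∑ χᵢ(g) Eᵢ` attached to orthogonal idempotents `Eᵢ` and
characters `χᵢ`. -/
def diagonalHom {E : ι → A} (hE : CompleteOrthogonalIdempotents E) {G : Type*} [Group G]
    (χ : ι → G →* kˣ) : G →* Aˣ :=
  MonoidHom.toHomUnits
    { toFun g := ∑ i, (χ i g : k) • E i
      map_one' := by simpa using hE.complete
      map_mul' g h := by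
        classical
        simp only [Finset.sum_mul_sum, smul_mul_smul_comm, hE.toOrthogonalIdempotents.mul_eq]
        simp }

variable {E : ι → A} (hE : CompleteOrthogonalIdempotents E)

@[simp]
theorem diagonalHom_val {G : Type*} [Group G] (χ : ι → G →* kˣ) (g : G) :
    (diagonalHom hE χ g : A) = ∑ i, (χ i g : k) • E i := rfl

theorem mul_diagonalHom {G : Type*} [Group G] (χ : ι → G →* kˣ) (g : G) (i : ι) :
    E i * (diagonalHom hE χ g : A) = (χ i g : k) • E i := by
  classical
  simp [Finset.mul_sum, hE.toOrthogonalIdempotents.mul_eq]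

/-- Each diagonal character is a matrix coefficient, hence regular on the image: multiply by `E i`
and apply a functional that is nonzero on `E i`. -/
theorem exists_dual_apply_diagonalHom {G : Type*} [Group G] (χ : ι → G →* kˣ) (i : ι)
    (hi : E i ≠ 0) : ∃ l : Module.Dual k A, ∀ g, l (diagonalHom hE χ g : A) = χ i g := by
  obtain ⟨f, hf⟩ := Module.Projective.exists_dual_ne_zero k hi
  refine ⟨(f (E i))⁻¹ • f ∘ₗ LinearMap.mulLeft k (E i), fun g => ?_⟩
  simp only [LinearMap.smul_apply, LinearMap.comp_apply, LinearMap.mulLeft_apply,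
    mul_diagonalHom, map_smul, smul_eq_mul]
  field_simp

/-- Since `k` is algebraically closed, kˣ is divisible, hence an injective ℤ-module; a homomorphism
into it from the sublattice spanned by `β` extends to ℤⁿ, and such an extension is a point of 𝔾ₘⁿ.
-/
theorem exists_extension_of_linearIndependent [IsAlgClosed k] {n r : ℕ} {β : Fin r → Fin n → ℤ}
    (hβ : LinearIndependent ℤ β) (u : Fin r → kˣ) :
    ∃ t : (Fin n → k)ˣ, ∀ j, monomialChar (β j) t = u j := by
  have hdiv : ∀ (m : ℤ), m ≠ 0 → Function.Surjective fun a : Additive kˣ => m • a := by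
    have hnat : ∀ (m : ℕ), m ≠ 0 → ∀ x : kˣ, ∃ y : kˣ, y ^ m = x := by
      intro m hm x
      obtain ⟨z, hz⟩ := IsAlgClosed.exists_pow_nat_eq (x : k) (Nat.pos_of_ne_zero hm)
      have hz0 : z ≠ 0 := by
        rintro rfl
        rw [zero_pow hm] at hz
        exact x.ne_zero hz.symm
      exact ⟨Units.mk0 z hz0, Units.ext (by simpa using hz)⟩
    intro m hm x
    obtain ⟨y, hy⟩ := hnat m.natAbs (Int.natAbs_ne_zero.2 hm) x.toMul
    rcases Int.eq_nat_or_neg m with ⟨p, rfl | rfl⟩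
    · exact ⟨Additive.ofMul y, Additive.toMul.injective (by simpa using hy)⟩
    · exact ⟨Additive.ofMul y⁻¹, Additive.toMul.injective (by simpa using hy)⟩
  let : DivisibleBy (Additive kˣ) ℤ := divisibleByOfSMulRightSurj _ _ fun {m} hm => hdiv m hm
  let f : (Fin r → ℤ) →ₗ[ℤ] (Fin n → ℤ) := Fintype.linearCombination ℤ β
  obtain ⟨h, hh⟩ := (Module.Baer.of_divisible (Additive kˣ)).extension_property f
    (linearIndependent_iff_injective_fintypeLinearCombination.1 hβ)
    (Fintype.linearCombination ℤ fun j => Additive.ofMul (u j))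
  refine ⟨unitsOfCoords fun i => (h (Pi.single i 1)).toMul, fun j => ?_⟩
  have h1 := LinearMap.congr_fun hh (Pi.single j 1)
  simp only [LinearMap.comp_apply, f, Fintype.linearCombination_apply_single, one_smul] at h1
  rw [monomialChar_apply]
  simp only [coordChar_unitsOfCoords]
  apply Additive.ofMul.injective
  rw [← h1, ofMul_prod]
  conv_rhs => rw [← Finset.univ_sum_single (β j)]
  rw [map_sum]
  refine Finset.sum_congr rfl fun i _ => ?_
  have : (Pi.single i (β j i) : Fin n → ℤ) = β j i • Pi.single i 1 := by
    rw [← Pi.single_smul]; simp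
  rw [this, map_smul]
  rfl

/-- The image of a diagonal representation of `𝔾ₘⁿ` is a torus. -/
theorem isTorus_range_diagonalHom [IsAlgClosed k] {n : ℕ} (w : ι → Fin n → ℤ)
    (hne : ∀ i, E i ≠ 0) :
    IsTorus k (diagonalHom hE fun i => monomialChar (k := k) (w i)).range := by
  -- The representation of 𝔾ₘⁿ may have a kernel. Replacing ℤⁿ by the lattice spanned by the weights
  -- gives a torus 𝔾ₘʳ with the same image, on which the representation is faithful.
  let L : Submodule ℤ (Fin n → ℤ) := Submodule.span ℤ (Set.range w)
  let β := Module.finBasis ℤ L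
  set r := Module.finrank ℤ L
  have hwL : ∀ i, w i ∈ L := fun i => Submodule.subset_span ⟨i, rfl⟩
  let m : ι → Fin r → ℤ := fun i => β.repr ⟨w i, hwL i⟩
  have hm : ∀ i, w i = ∑ j, m i j • (β j : Fin n → ℤ) := by
    intro i
    have := congrArg Subtype.val (β.sum_repr ⟨w i, hwL i⟩)
    rw [Submodule.coe_sum] at this
    exact this.symm
  have hc : ∀ j, ∃ c : ι → ℤ, ∑ i, c i • m i = Pi.single j 1 := by
    intro j
    obtain ⟨c, hc⟩ := (Submodule.mem_span_range_iff_exists_fun ℤ).1 (β j).2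
    refine ⟨c, ?_⟩
    have h1 : ∑ i, c i • (⟨w i, hwL i⟩ : L) = β j := Subtype.ext (by simpa using hc)
    have h2 := congrArg β.equivFun h1
    rw [map_sum] at h2
    simp only [map_smul] at h2
    refine Eq.trans h2 ?_
    funext i
    rw [Module.Basis.equivFun_self, Pi.single_apply]
    simp [eq_comm]
  choose c hc using hc
  let φ : (Fin r → k)ˣ →* Aˣ := diagonalHom hE fun i => monomialChar (m i)
  have hrange : (diagonalHom hE fun i => monomialChar (k := k) (w i)).range = φ.range := by
    have hres : ∀ (t : (Fin n → k)ˣ) (u : (Fin r → k)ˣ),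
        (∀ j, monomialChar (β j : Fin n → ℤ) t = coordChar j u) →
        diagonalHom hE (fun i => monomialChar (k := k) (w i)) t = φ u := by
      intro t u h
      refine Units.ext (Finset.sum_congr rfl fun i _ => ?_)
      have : monomialChar (w i) t = monomialChar (m i) u := by
        rw [hm i, monomialChar_sum, monomialChar_apply]
        simp [MonoidHom.finsetProd_apply, h]
      rw [this]
    apply le_antisymm
    · rintro _ ⟨t, rfl⟩
      exact ⟨unitsOfCoords fun j => monomialChar (β j : Fin n → ℤ) t,
        (hres t _ fun j => rfl).symm⟩
    · rintro _ ⟨u, rfl⟩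
      have hli : LinearIndependent ℤ fun j => (β j : Fin n → ℤ) :=
        β.linearIndependent.map' L.subtype (Submodule.ker_subtype L)
      obtain ⟨t, ht⟩ := exists_extension_of_linearIndependent hli fun j => coordChar j u
      exact ⟨t, hres t u ht⟩
  -- The weights generate the new lattice, so each coordinate is a Laurent monomial in the diagonal
  -- characters. This yields both injectivity and the regularity of the inverse.
  have hcoord : ∀ (u : (Fin r → k)ˣ) (j : Fin r),
      coordChar j u = ∏ i, monomialChar (m i) u ^ c j i := by
    intro u j
    rw [← monomialChar_single, ← hc, monomialChar_sum]
    simp [MonoidHom.finsetProd_apply]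
  have hinj : Function.Injective φ := by
    intro u u' h
    have h1 : ∀ i, monomialChar (m i) u = monomialChar (m i) u' := by
      intro i
      obtain ⟨l, hl⟩ := exists_dual_apply_diagonalHom hE
        (fun i => monomialChar (k := k) (m i)) i (hne i)
      refine Units.ext ?_
      rw [← hl u, ← hl u']
      exact congrArg (fun x : Aˣ => l (x : A)) h
    rw [← unitsOfCoords_coordChar u, ← unitsOfCoords_coordChar u']
    simp only [hcoord, h1]
  rw [hrange]
  refine ⟨r, MonoidHom.ofInjective hinj, fun l => ?_, fun l => ?_⟩
  · have : (fun u => l ((φ.range.subtype ((MonoidHom.ofInjective hinj).toMonoidHom u) : Aˣ) : A)) =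
        ∑ i, l (E i) • fun u => (monomialChar (m i) u : k) := by
      funext u
      have : (φ.range.subtype ((MonoidHom.ofInjective hinj).toMonoidHom u) : Aˣ) = φ u := rfl
      rw [this]
      simp [φ, mul_comm]
    rw [← mem_regularFunctions]
    change (fun u => l ((φ.range.subtype ((MonoidHom.ofInjective hinj).toMonoidHom u) : Aˣ) : A)) ∈ _
    rw [this]
    exact sum_mem fun i _ => Subalgebra.smul_mem _ (monomialChar_mem_regularFunctions _) _
  · set e := (MonoidHom.ofInjective hinj).symm with he
    have hφe : ∀ g : φ.range, φ (e g) = g := fun g =>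
      congrArg Subtype.val ((MonoidHom.ofInjective hinj).apply_symm_apply g)
    have hχ : ∀ i (z : ℤ), (fun g : φ.range => ((monomialChar (m i) (e g) ^ z : kˣ) : k)) ∈
        regularFunctions k φ.range.subtype := by
      intro i z
      obtain ⟨l, hl⟩ := exists_dual_apply_diagonalHom hE
        (fun i => monomialChar (k := k) (m i)) i (hne i)
      rcases Int.eq_nat_or_neg z with ⟨p, rfl | rfl⟩
      · have := pow_mem (dual_mem_regularFunctions φ.range.subtype l) p
        convert this using 1
        funext g
        have : l ((g : Aˣ) : A) = monomialChar (m i) (e g) := by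
          rw [← hl]; exact congrArg (fun x : Aˣ => l (x : A)) (hφe g).symm
        simp [this]
      · have := pow_mem (dual_inv_mem_regularFunctions φ.range.subtype l) p
        convert this using 1
        funext g
        have : l (((g : Aˣ)⁻¹ : Aˣ) : A) = (monomialChar (m i) (e g))⁻¹ := by
          rw [← map_inv, ← hl, map_inv]
          exact congrArg (fun x : Aˣ => l ((x⁻¹ : Aˣ) : A)) (hφe g).symm
        simp [this]
    rw [← mem_regularFunctions]
    change (fun g => l ((e g : (Fin r → k)ˣ) : Fin r → k)) ∈ _
    simp only [dual_apply_eq_sum_coordChar]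
    have : (fun g => ∑ j, l (Pi.single j 1) * ((coordChar j (e g) : kˣ) : k)) =
        ∑ j, l (Pi.single j 1) •
          ∏ i, fun g => ((monomialChar (m i) (e g) ^ c j i : kˣ) : k) := by
      funext g
      simp [hcoord]
    rw [this]
    exact sum_mem fun j _ => Subalgebra.smul_mem _ (prod_mem fun i _ => hχ i _) _

end ImageTorus

/-! ### Isometries of odd order and hyperbolic bases of eigenvectors -/

section HyperbolicBasis

variable {k : Type*} [Field k] [IsAlgClosed k] [CharZero k]

/-- On the span of two independent vectors isotropy is one quadratic equation, solvable over an
algebraically closed field. -/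
theorem exists_isotropic_vector {V : Type*} [AddCommGroup V] [Module k V]
    (B : LinearMap.BilinForm k V) (hV : 1 < Module.finrank k V)
    (hs : ∀ x y, B x y = B y x) : ∃ v : V, v ≠ 0 ∧ B v v = 0 := by
  have := Module.finite_of_finrank_pos (lt_trans Nat.zero_lt_one hV)
  let b := Module.finBasis k V
  let v := b ⟨0, by omega⟩
  let w := b ⟨1, hV⟩
  by_cases hv : B v v = 0
  · exact ⟨v, b.ne_zero _, hv⟩
  · obtain ⟨s, hs'⟩ := IsAlgClosed.exists_eq_mul_self (discrim (B v v) (2 * B v w) (B w w))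
    obtain ⟨t, ht⟩ := exists_quadratic_eq_zero hv ⟨s, hs'⟩
    refine ⟨t • v + w, fun h => ?_, ?_⟩
    · have := congrArg (fun x => b.repr x ⟨1, hV⟩) h
      simp [v, w] at this
    · simp only [map_add, map_smul, LinearMap.add_apply, LinearMap.smul_apply, smul_eq_mul, hs w v]
      linear_combination ht

/-- For g = 1 any hyperbolic pair will do. Otherwise there is an eigenvalue c ≠ 1, and oddness of
the order also excludes -1; hence c² ≠ 1, and invariance of `B` makes the eigenvectors for c and c⁻¹
isotropic. -/
theorem exists_hyperbolic_eigenpair {V : Type*} [AddCommGroup V] [Module k V]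
    (B : LinearMap.BilinForm k V) (hV : 1 < Module.finrank k V)
    (hs : ∀ x y, B x y = B y x) (hB : ∀ x, (∀ y, B x y = 0) → x = 0)
    (g : V →ₗ[k] V) (hg : ∀ x y, B (g x) (g y) = B x y) {m : ℕ} (hm : Odd m) (hgm : g ^ m = 1) :
    ∃ (e f : V) (c : k), c ≠ 0 ∧ B e e = 0 ∧ B f f = 0 ∧ B e f = 1 ∧
      g e = c • e ∧ g f = c⁻¹ • f := by
  have hfin := Module.finite_of_finrank_pos (lt_trans Nat.zero_lt_one hV)
  have hdual : ∀ x, x ≠ 0 → ∃ y, B x y = 1 := by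
    intro x hx
    obtain ⟨y, hy⟩ := not_forall.1 fun h => hx (hB x h)
    exact ⟨(B x y)⁻¹ • y, by simp [hy]⟩
  have hm0 : (m : k) ≠ 0 := Nat.cast_ne_zero.2 hm.pos.ne'
  by_cases h1 : g = 1
  · obtain ⟨e, he, hee⟩ := exists_isotropic_vector B hV hs
    obtain ⟨y, hy⟩ := hdual e he
    refine ⟨e, y - (B y y / 2) • e, 1, one_ne_zero, hee, ?_, ?_, by simp [h1], by simp [h1]⟩
    · simp only [map_sub, map_smul, LinearMap.sub_apply, LinearMap.smul_apply, smul_eq_mul,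
        hee, hs y e, hy]
      ring
    · simp [hy, hee]
  -- An eigenvector is sought inside the image of g - 1, where the eigenvalue 1 cannot occur.
  · have hU : LinearMap.range (g - 1) ≠ ⊥ := fun h => h1 (sub_eq_zero.1 (LinearMap.range_eq_bot.1 h))
    have hmap : ∀ x ∈ LinearMap.range (g - 1), g x ∈ LinearMap.range (g - 1) := by
      rintro _ ⟨w, rfl⟩
      exact ⟨g w, by simp⟩
    have := Submodule.nontrivial_iff_ne_bot.2 hU
    obtain ⟨c, hc⟩ := Module.End.exists_eigenvalue (g.restrict hmap)
    obtain ⟨⟨u, w, hw⟩, hu⟩ := hc.exists_hasEigenvector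
    have hgu : g u = c • u := congrArg Subtype.val hu.apply_eq_smul
    have hu0 : u ≠ 0 := fun h => hu.2 (Subtype.ext h)
    have hpow : ∀ j : ℕ, (g ^ j) u = c ^ j • u := by
      intro j
      induction j with
      | zero => simp
      | succ j ih => rw [pow_succ', Module.End.mul_apply, ih, map_smul, hgu, smul_smul, pow_succ]
    have hcm : c ^ m = 1 := by
      have := hpow m
      rw [hgm, Module.End.one_apply] at this
      have h2 : (c ^ m - 1) • u = 0 := by rw [sub_smul, ← this, one_smul, sub_self]
      exact sub_eq_zero.1 ((smul_eq_zero.1 h2).resolve_right hu0)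
    have hc0 : c ≠ 0 := by
      rintro rfl
      rw [zero_pow hm.pos.ne'] at hcm
      exact zero_ne_one hcm
    have hc1 : c ≠ 1 := by
      rintro rfl
      -- For u = (g - 1)w this sum telescopes to gᵐw - w = 0, whereas eigenvalue 1 would make it m ·
      -- u.
      have h2 : ∑ j ∈ Finset.range m, (g ^ j) u = 0 := by
        rw [← hw]
        have : ∀ j, (g ^ j) ((g - 1) w) = (g ^ (j + 1)) w - (g ^ j) w := by
          intro j
          rw [pow_succ, Module.End.mul_apply, ← map_sub]; rfl
        simp only [this]
        rw [Finset.sum_range_sub (fun j => (g ^ j) w), hgm, pow_zero, sub_self]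
      simp only [hpow, one_pow, one_smul, Finset.sum_const, Finset.card_range] at h2
      rw [← Nat.cast_smul_eq_nsmul k] at h2
      exact (smul_eq_zero.1 h2).elim hm0 hu0
    have hc2 : c * c ≠ 1 := by
      intro h
      rcases mul_self_eq_one_iff.1 h with h | h
      · exact hc1 h
      · rw [h, hm.neg_one_pow] at hcm
        norm_num at hcm
    obtain ⟨y, hy⟩ := hdual u hu0
    -- The projection of `y` to the eigenspace of c⁻¹; averaging preserves the pairing with `u`.
    let f : V := (m : k)⁻¹ • ∑ j ∈ Finset.range m, c ^ j • (g ^ j) y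
    have hgf : g f = c⁻¹ • f := by
      have h3 : ∀ j, g (c ^ j • (g ^ j) y) = c⁻¹ • (c ^ (j + 1) • (g ^ (j + 1)) y) := by
        intro j
        rw [map_smul, smul_smul, pow_succ' g, Module.End.mul_apply, pow_succ']
        congr 1
        field_simp
      have h4 : ∑ j ∈ Finset.range m, c ^ (j + 1) • (g ^ (j + 1)) y =
          ∑ j ∈ Finset.range m, c ^ j • (g ^ j) y := by
        have := Finset.sum_range_sub (fun j => c ^ j • (g ^ j) y) m
        rw [Finset.sum_sub_distrib, hcm, hgm] at this
        simpa [sub_eq_zero] using this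
      simp only [f, map_smul, map_sum, h3]
      rw [← Finset.smul_sum, h4, smul_comm]
    have hpres : ∀ (j : ℕ) x y, B ((g ^ j) x) ((g ^ j) y) = B x y := by
      intro j
      induction j with
      | zero => simp
      | succ j ih => intro x y; rw [pow_succ', Module.End.mul_apply, Module.End.mul_apply, hg, ih]
    refine ⟨u, f, c, hc0, ?_, ?_, ?_, hgu, hgf⟩
    · have := hg u u
      rw [hgu] at this
      simp only [map_smul, LinearMap.smul_apply, smul_eq_mul] at this
      have h5 : (c * c - 1) * B u u = 0 := by linear_combination this
      exact (mul_eq_zero.1 h5).resolve_left (sub_ne_zero.2 hc2)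
    · have := hg f f
      rw [hgf] at this
      simp only [map_smul, LinearMap.smul_apply, smul_eq_mul] at this
      have h5 : (c * c - 1) * B f f = 0 := by
        field_simp at this
        linear_combination -this
      exact (mul_eq_zero.1 h5).resolve_left (sub_ne_zero.2 hc2)
    · have h6 : ∀ j, c ^ j * B u ((g ^ j) y) = 1 := by
        intro j
        have := hpres j u y
        rwa [hpow, map_smul, LinearMap.smul_apply, smul_eq_mul, hy] at this
      simp only [f, map_smul, map_sum, smul_eq_mul, h6]
      simp [hm0]

/-- An isometry of odd order of a nondegenerate form of even dimension has a hyperbolic basis of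
eigenvectors. -/
theorem exists_hyperbolic_eigenbasis {V : Type*} [AddCommGroup V] [Module k V]
    [FiniteDimensional k V] (n : ℕ) (hV : Module.finrank k V = 2 * n) (B : LinearMap.BilinForm k V)
    (hs : ∀ x y, B x y = B y x) (hB : ∀ x, (∀ y, B x y = 0) → x = 0)
    (g : V →ₗ[k] V) (hg : ∀ x y, B (g x) (g y) = B x y) {m : ℕ} (hm : Odd m) (hgm : g ^ m = 1) :
    ∃ (e f : Fin n → V) (c : Fin n → k), (∀ i, c i ≠ 0) ∧ (∀ i j, B (e i) (e j) = 0) ∧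
      (∀ i j, B (f i) (f j) = 0) ∧ (∀ i j, B (e i) (f j) = if i = j then 1 else 0) ∧
      (∀ i, g (e i) = c i • e i) ∧ (∀ i, g (f i) = (c i)⁻¹ • f i) ∧
      ∀ v, v = ∑ i, (B v (f i) • e i + B v (e i) • f i) := by
  induction n generalizing V with
  | zero =>
    have := Module.finrank_zero_iff.1 hV
    exact ⟨Fin.elim0, Fin.elim0, Fin.elim0, fun i => i.elim0, fun i => i.elim0, fun i => i.elim0,
      fun i => i.elim0, fun i => i.elim0, fun i => i.elim0, fun v => Subsingleton.elim _ _⟩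
  | succ n ih =>
    obtain ⟨e₀, f₀, c₀, hc₀, hee, hff, hef, hge, hgf⟩ :=
      exists_hyperbolic_eigenpair B (by omega) hs hB g hg hm hgm
    -- The kernel is the orthogonal complement of the hyperbolic plane just found; it is `g`-stable
    -- and nondegenerate, and the induction continues there.
    let p : V →ₗ[k] k × k := (B e₀).prod (B f₀)
    let W := LinearMap.ker p
    have hW : ∀ w, w ∈ W ↔ B e₀ w = 0 ∧ B f₀ w = 0 := fun w => by
      simp [W, p]
    have hp : Function.Surjective p := by
      rintro ⟨a, b⟩
      exact ⟨a • f₀ + b • e₀, by simp [p, hee, hff, hef, hs f₀ e₀]⟩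
    have hdim : Module.finrank k W = 2 * n := by
      have := LinearMap.finrank_range_add_finrank_ker p
      rw [LinearMap.range_eq_top.2 hp, finrank_top, Module.finrank_prod, Module.finrank_self] at this
      change 1 + 1 + Module.finrank k W = _ at this
      omega
    have hproj : ∀ v, v - B v f₀ • e₀ - B v e₀ • f₀ ∈ W := by
      intro v
      rw [hW]
      simp [hee, hff, hef, hs f₀ e₀, hs v]
    have hgW : ∀ w ∈ W, g w ∈ W := by
      intro w hw
      rw [hW] at hw ⊢
      constructor
      · have := hg e₀ w
        rw [hge, hw.1] at this
        simpa [hc₀] using this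
      · have := hg f₀ w
        rw [hgf, hw.2] at this
        simpa [hc₀] using this
    let B' : LinearMap.BilinForm k W := B.restrict W
    have hB' : ∀ x y : W, B' x y = B x y := fun _ _ => rfl
    have hpow : ∀ (j : ℕ) (w : W), (((g.restrict hgW) ^ j) w : V) = (g ^ j) w := by
      intro j
      induction j with
      | zero => simp
      | succ j ih => intro w; rw [pow_succ, pow_succ, Module.End.mul_apply, ih]; rfl
    obtain ⟨e, f, c, hc, h1, h2, h3, h4, h5, h6⟩ := ih hdim B' (fun x y => hs _ _)
      (fun x hx => Subtype.ext (hB x fun y => by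
        have h7 := hx ⟨_, hproj y⟩
        rw [hB'] at h7
        have hx' := (hW x).1 x.2
        simpa [hs x, hx'.1, hx'.2] using h7)) (g.restrict hgW) (fun x y => hg _ _)
      (LinearMap.ext fun w => Subtype.ext (by rw [hpow, hgm]; rfl))
    have heW := fun i => (hW _).1 (e i).2
    have hfW := fun i => (hW _).1 (f i).2
    refine ⟨Fin.cons e₀ fun i => e i, Fin.cons f₀ fun i => f i, Fin.cons c₀ c,
      Fin.cases hc₀ hc, ?_, ?_, ?_, ?_, ?_, fun v => ?_⟩
    · refine Fin.cases (Fin.cases hee fun j => ?_) fun i => Fin.cases ?_ fun j => ?_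
      · simpa using (heW j).1
      · simpa [hs _ e₀] using (heW i).1
      · exact h1 i j
    · refine Fin.cases (Fin.cases hff fun j => ?_) fun i => Fin.cases ?_ fun j => ?_
      · simpa using (hfW j).2
      · simpa [hs _ f₀] using (hfW i).2
      · exact h2 i j
    · refine Fin.cases (Fin.cases (by simpa using hef) fun j => ?_)
        fun i => Fin.cases ?_ fun j => ?_
      · simpa [(Fin.succ_ne_zero j).symm] using (hfW j).1
      · simpa [hs _ f₀] using (heW i).2
      · have := h3 i j
        rw [hB'] at this
        simpa using this
    · exact Fin.cases hge fun i => congrArg Subtype.val (h4 i)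
    · exact Fin.cases hgf fun i => congrArg Subtype.val (h5 i)
    · have h7 := congrArg Subtype.val (h6 ⟨_, hproj v⟩)
      simp only [Submodule.coe_sum, Submodule.coe_add, Submodule.coe_smul, hB'] at h7
      have h8 : ∀ i, B (v - B v f₀ • e₀ - B v e₀ • f₀) (e i) = B v (e i) := fun i => by
        simp [(heW i).1, (heW i).2]
      have h9 : ∀ i, B (v - B v f₀ • e₀ - B v e₀ • f₀) (f i) = B v (f i) := fun i => by
        simp [(hfW i).1, (hfW i).2]
      simp only [h8, h9] at h7
      rw [Fin.sum_univ_succ]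
      simp only [Fin.cons_zero, Fin.cons_succ, ← h7]
      abel

end HyperbolicBasis

/-! ### Clifford algebras generated by anticommuting square roots of 1 -/

section CliffordAlgebras

open CliffordAlgebra

variable {k V : Type*} [Field k] [AddCommGroup V] [Module k V]

/-- A family of vectors whose images in the Clifford algebra are anticommuting square roots of `1`
generating it. -/
structure IsOrthonormalGenerating {d : ℕ} (Q : QuadraticForm k V) (v : Fin d → V) : Prop where
  sq : ∀ i, ι Q (v i) * ι Q (v i) = 1
  anti : ∀ i j, i ≠ j → ι Q (v i) * ι Q (v j) = -(ι Q (v j) * ι Q (v i))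
  span : Submodule.span k (Set.range v) = ⊤

theorem exists_isOrthonormalGenerating [IsAlgClosed k] [CharZero k] [FiniteDimensional k V]
    (Q : QuadraticForm k V) (hQ : Q.polarBilin.Nondegenerate) :
    ∃ v : Fin (Module.finrank k V) → V, IsOrthonormalGenerating Q v := by
  have : Invertible (2 : k) := invertibleOfNonzero two_ne_zero
  obtain ⟨φ⟩ := Q.equivalent_weightedSumSquares_of_isAlgClosed (fun x hx => hQ.1 x fun y => by
    rw [← QuadraticMap.two_nsmul_associated k Q]
    exact (congrArg (2 • ·) (hx y)).trans (smul_zero _))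
  have hφ : ∀ w, Q (φ.toLinearEquiv.symm w) = ∑ i, w i * w i := by
    intro w
    have := φ.map_app (φ.toLinearEquiv.symm w)
    rw [← this, QuadraticMap.weightedSumSquares_apply]
    simp
  refine ⟨fun i => φ.toLinearEquiv.symm (Pi.single i 1), fun i => ?_, fun i j hij => ?_, ?_⟩
  · rw [ι_sq_scalar, hφ, Finset.sum_eq_single i] <;> simp +contextual
  · have hp : QuadraticMap.polar Q (φ.toLinearEquiv.symm (Pi.single i 1))
        (φ.toLinearEquiv.symm (Pi.single j 1)) = 0 := by
      rw [QuadraticMap.polar, ← map_add, hφ, hφ, hφ, ← Finset.sum_sub_distrib,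
        ← Finset.sum_sub_distrib]
      refine Finset.sum_eq_zero fun l _ => ?_
      simp only [Pi.add_apply, Pi.single_apply]
      split_ifs with h1 h2
      · exact absurd (h1.symm.trans h2) hij
      all_goals ring
    have := ι_mul_ι_add_swap (Q := Q) (φ.toLinearEquiv.symm (Pi.single i 1))
      (φ.toLinearEquiv.symm (Pi.single j 1))
    rw [hp, map_zero] at this
    exact eq_neg_of_add_eq_zero_left this
  · have := ((Pi.basisFun k (Fin (Module.finrank k V))).map φ.toLinearEquiv.symm).span_eq
    rw [← this]
    congr 2
    funext i
    simp

namespace IsOrthonormalGenerating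

variable {d : ℕ} {Q : QuadraticForm k V} {v : Fin d → V} (hv : IsOrthonormalGenerating Q v)

variable (Q v) in
/-- The subalgebra of the Clifford algebra generated by the vectors indexed by `s`. -/
def subalg (s : Finset (Fin d)) : Subalgebra k (CliffordAlgebra Q) :=
  Algebra.adjoin k ((fun i => ι Q (v i)) '' s)

theorem subalg_mono {s t : Finset (Fin d)} (h : s ⊆ t) : subalg Q v s ≤ subalg Q v t :=
  Algebra.adjoin_mono (Set.image_mono h)

include hv

theorem subalg_univ : subalg Q v Finset.univ = ⊤ := by
  rw [eq_top_iff, ← adjoin_range_ι]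
  refine Algebra.adjoin_le ?_
  rintro _ ⟨w, rfl⟩
  have hw : w ∈ Submodule.span k (Set.range v) := hv.span ▸ Submodule.mem_top
  induction hw using Submodule.span_induction with
  | mem x hx =>
    obtain ⟨i, rfl⟩ := hx
    exact Algebra.subset_adjoin ⟨i, by simp, rfl⟩
  | zero => simp
  | add x y _ _ hx hy => rw [map_add]; exact add_mem hx hy
  | smul a x _ hx => rw [map_smul]; exact Subalgebra.smul_mem _ hx a

omit hv in
theorem involute_mem_subalg {s : Finset (Fin d)} {a : CliffordAlgebra Q} (ha : a ∈ subalg Q v s) :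
    involute a ∈ subalg Q v s := by
  induction ha using Algebra.adjoin_induction with
  | mem x hx =>
    obtain ⟨i, hi, rfl⟩ := hx
    rw [involute_ι]
    exact neg_mem (Algebra.subset_adjoin ⟨i, hi, rfl⟩)
  | algebraMap r => rw [AlgHom.commutes]; exact Subalgebra.algebraMap_mem _ r
  | add x y _ _ hx hy => rw [map_add]; exact add_mem hx hy
  | mul x y _ _ hx hy => rw [map_mul]; exact mul_mem hx hy

theorem mul_subalg {s : Finset (Fin d)} {i : Fin d} (hi : i ∉ s) {a : CliffordAlgebra Q}
    (ha : a ∈ subalg Q v s) : ι Q (v i) * a = involute a * ι Q (v i) := by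
  induction ha using Algebra.adjoin_induction with
  | mem x hx =>
    obtain ⟨j, hj, rfl⟩ := hx
    have hij : i ≠ j := fun h => hi (h ▸ hj)
    simp only [involute_ι, neg_mul]
    exact hv.anti i j hij
  | algebraMap r => rw [AlgHom.commutes]; exact (Algebra.commutes r _).symm
  | add x y _ _ hx hy => rw [map_add, mul_add, add_mul, hx, hy]
  | mul x y _ _ hx hy => rw [map_mul, ← mul_assoc, hx, mul_assoc, hy, mul_assoc]

/-- Moving the new generator to the right past the others costs only the grade involution, and its
square is 1, so elements of this shape are closed under multiplication. -/
theorem exists_of_mem_subalg_insert {s : Finset (Fin d)} {i : Fin d} (hi : i ∉ s)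
    {y : CliffordAlgebra Q} (hy : y ∈ subalg Q v (insert i s)) :
    ∃ a ∈ subalg Q v s, ∃ b ∈ subalg Q v s, y = a + b * ι Q (v i) := by
  induction hy using Algebra.adjoin_induction with
  | mem x hx =>
    obtain ⟨j, hj, rfl⟩ := hx
    rcases Finset.mem_insert.1 hj with rfl | hj
    · exact ⟨0, zero_mem _, 1, one_mem _, by simp⟩
    · exact ⟨_, Algebra.subset_adjoin ⟨j, hj, rfl⟩, 0, zero_mem _, by simp⟩
  | algebraMap r => exact ⟨_, Subalgebra.algebraMap_mem _ r, 0, zero_mem _, by simp⟩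
  | add x y _ _ hx hy =>
    obtain ⟨a, ha, b, hb, rfl⟩ := hx
    obtain ⟨a', ha', b', hb', rfl⟩ := hy
    exact ⟨a + a', add_mem ha ha', b + b', add_mem hb hb', by rw [add_mul]; abel⟩
  | mul x y _ _ hx hy =>
    obtain ⟨a, ha, b, hb, rfl⟩ := hx
    obtain ⟨a', ha', b', hb', rfl⟩ := hy
    refine ⟨a * a' + b * involute b',
      add_mem (mul_mem ha ha') (mul_mem hb (involute_mem_subalg hb')),
      a * b' + b * involute a',
      add_mem (mul_mem ha hb') (mul_mem hb (involute_mem_subalg ha')), ?_⟩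
    have h1 := hv.mul_subalg hi ha'
    have h2 := hv.mul_subalg hi hb'
    have h3 : b * ι Q (v i) * (b' * ι Q (v i)) = b * involute b' := by
      rw [mul_assoc, ← mul_assoc (ι Q (v i)), h2, mul_assoc, hv.sq, mul_one]
    have h4 : b * ι Q (v i) * a' = b * involute a' * ι Q (v i) := by
      rw [mul_assoc, h1, mul_assoc]
    rw [add_mul, mul_add, mul_add, h3, h4, add_mul, mul_assoc a]
    abel

theorem finiteDimensional : FiniteDimensional k (CliffordAlgebra Q) := by
  classical
  have h : ∀ s : Finset (Fin d), (Subalgebra.toSubmodule (subalg Q v s)).FG := by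
    intro s
    induction s using Finset.induction_on with
    | empty =>
      have : subalg Q v ∅ = ⊥ := by simp [subalg]
      rw [this]
      exact Subalgebra.fg_bot_toSubmodule
    | insert i s hi ih =>
      have : Subalgebra.toSubmodule (subalg Q v (insert i s)) =
          Subalgebra.toSubmodule (subalg Q v s) ⊔
            (Subalgebra.toSubmodule (subalg Q v s)).map (LinearMap.mulRight k (ι Q (v i))) := by
        apply le_antisymm
        · intro y hy
          obtain ⟨a, ha, b, hb, rfl⟩ := hv.exists_of_mem_subalg_insert hi hy
          exact Submodule.add_mem_sup ha ⟨b, hb, rfl⟩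
        · refine sup_le (subalg_mono (Finset.subset_insert i s)) ?_
          rintro _ ⟨b, hb, rfl⟩
          exact Subalgebra.mul_mem _ (subalg_mono (Finset.subset_insert i s) hb)
            (Algebra.subset_adjoin ⟨i, by simp, rfl⟩)
      rw [this]
      exact ih.sup (ih.map _)
  have := h Finset.univ
  rw [hv.subalg_univ, Algebra.top_toSubmodule] at this
  exact ⟨this⟩

/-- An even element of the Clifford algebra which commutes with all vectors is a scalar. -/
theorem mem_bot_of_commute [CharZero k] {y : CliffordAlgebra Q} (hy : involute y = y)
    (hc : ∀ w, ι Q w * y = y * ι Q w) : y ∈ (⊥ : Subalgebra k (CliffordAlgebra Q)) := by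
  classical
  have h : ∀ s : Finset (Fin d), y ∈ subalg Q v s → y ∈ (⊥ : Subalgebra k _) := by
    intro s
    induction s using Finset.induction_on with
    | empty => intro h; simpa [subalg] using h
    | insert i s hi ih =>
      intro h
      -- Evenness and commutation with the generator give two equations for `a` and `b` whose
      -- difference is 2 · `involute b` = 0. So `b` vanishes and the generators can be removed one
      -- at a time.
      obtain ⟨a, ha, b, hb, hab⟩ := hv.exists_of_mem_subalg_insert hi h
      have h1 := hv.mul_subalg hi ha
      have h2 := hv.mul_subalg hi hb
      have h3 : involute a - involute b * ι Q (v i) = a + b * ι Q (v i) := by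
        rw [hab, map_add, map_mul, involute_ι, mul_neg, ← sub_eq_add_neg] at hy
        exact hy
      have h4 : involute a * ι Q (v i) + involute b = a * ι Q (v i) + b := by
        have := hc (v i)
        rw [hab, mul_add, add_mul, ← mul_assoc, h1, h2, mul_assoc, mul_assoc, hv.sq, mul_one,
          mul_one] at this
        exact this
      have h5 : involute a * ι Q (v i) - involute b = a * ι Q (v i) + b := by
        have := congrArg (· * ι Q (v i)) h3
        simpa [sub_mul, add_mul, mul_assoc, hv.sq] using this
      have h6 : (2 : k) • involute b = 0 := by
        rw [two_smul]
        have := h4.trans h5.symm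
        rw [sub_eq_add_neg, add_right_inj] at this
        rw [← sub_neg_eq_add, sub_eq_zero]; exact this
      have h7 : b = 0 := by
        have := (smul_eq_zero.1 h6).resolve_left two_ne_zero
        rw [← involute_involute b, this, map_zero]
      exact ih (by rw [hab, h7, zero_mul, add_zero]; exact ha)
  exact h Finset.univ (hv.subalg_univ ▸ Algebra.mem_top)

end IsOrthonormalGenerating

end CliffordAlgebras

/-! ### Injectivity of representations on products of two vectors -/

section TraceForm

open CliffordAlgebra

variable {k V : Type*} [Field k] [CharZero k] [AddCommGroup V] [Module k V]
variable {d : ℕ} {Q : QuadraticForm k V} {v : Fin d → V}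
variable {S : Type*} [AddCommGroup S] [Module k S]

/-- The product of two vectors as an element of the even Clifford algebra. -/
def evenProd (Q : QuadraticForm k V) (v w : V) : even Q := (even.ι Q).bilin v w

omit [CharZero k] in
@[simp]
theorem coe_evenProd (v w : V) : (evenProd Q v w : CliffordAlgebra Q) = ι Q v * ι Q w := rfl

namespace IsOrthonormalGenerating

variable (hv : IsOrthonormalGenerating Q v) (π : even Q →ₐ[k] Module.End k S)

include hv

/-- The product of two generators is invertible, so anticommuting with it makes π z conjugate to its
negative. -/
theorem trace_eq_zero {a b : Fin d} {z : even Q}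
    (hz : evenProd Q (v a) (v b) * z = -(z * evenProd Q (v a) (v b))) :
    LinearMap.trace k S (π z) = 0 := by
  have h1 : evenProd Q (v a) (v b) * evenProd Q (v b) (v a) = 1 := Subtype.ext (by
    simp only [MulMemClass.coe_mul, coe_evenProd, OneMemClass.coe_one]
    rw [mul_assoc, ← mul_assoc (ι Q (v b)), hv.sq, one_mul, hv.sq])
  have h2 : evenProd Q (v b) (v a) * evenProd Q (v a) (v b) = 1 := Subtype.ext (by
    simp only [MulMemClass.coe_mul, coe_evenProd, OneMemClass.coe_one]
    rw [mul_assoc, ← mul_assoc (ι Q (v a)), hv.sq, one_mul, hv.sq])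
  have h3 : LinearMap.trace k S (π z) = -LinearMap.trace k S (π z) := by
    calc LinearMap.trace k S (π z)
        = LinearMap.trace k S (π (evenProd Q (v b) (v a)) * π (evenProd Q (v a) (v b) * z)) := by
          rw [← map_mul, ← mul_assoc, h2, one_mul]
      _ = LinearMap.trace k S (π (evenProd Q (v a) (v b) * z) * π (evenProd Q (v b) (v a))) :=
          LinearMap.trace_mul_comm _ _ _
      _ = -LinearMap.trace k S (π z) := by
          rw [hz, ← map_mul, neg_mul, mul_assoc, h1, mul_one, map_neg, map_neg]
  linear_combination (1 / 2 : k) * h3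

/-- The product of four generators anticommutes with some vₐv_b. Take `b` different from all four
indices, which is possible as d > 4; then v_b commutes with the product, and `a` is chosen among the
four indices so that vₐ anticommutes with it. -/
theorem trace_mul_eq_zero (hd : 4 < d) {i j p q : Fin d} (hpq : p ≠ q)
    (h1 : ¬(i = p ∧ j = q)) (h2 : ¬(i = q ∧ j = p)) :
    LinearMap.trace k S (π (evenProd Q (v i) (v j) * evenProd Q (v q) (v p))) = 0 := by
  classical
  let ε : Fin d → Fin d → k := fun a b => if a = b then 1 else -1
  have hε : ∀ a b, ι Q (v a) * ι Q (v b) = ε a b • (ι Q (v b) * ι Q (v a)) := by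
    intro a b
    by_cases hab : a = b
    · subst hab; simp [ε]
    · simp only [ε, if_neg hab, neg_smul, one_smul]; exact hv.anti a b hab
  obtain ⟨b, hb⟩ : ∃ b, b ∉ ({i, j, p, q} : Finset (Fin d)) := by
    by_contra! h
    have h3 : (Finset.univ : Finset (Fin d)) ⊆ {i, j, p, q} := fun x _ => h x
    have h4 := Finset.card_le_card h3
    have h5 := Finset.card_le_four (a := i) (b := j) (c := p) (d := q)
    rw [Finset.card_univ, Fintype.card_fin] at h4
    omega
  simp only [Finset.mem_insert, Finset.mem_singleton, not_or] at hb
  obtain ⟨a, ha⟩ : ∃ a, ε a i * ε a j * (ε a q * ε a p) = -1 := by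
    by_cases hij : i = j
    · exact ⟨p, by subst hij; simp only [ε, if_neg hpq]; split_ifs <;> norm_num⟩
    · by_cases hi : i = p ∨ i = q
      · refine ⟨j, ?_⟩
        have hjp : j ≠ p := by
          rintro rfl
          rcases hi with h | h
          · exact hij h
          · exact h2 ⟨h, rfl⟩
        have hjq : j ≠ q := by
          rintro rfl
          rcases hi with h | h
          · exact h1 ⟨h, rfl⟩
          · exact hij h
        simp [ε, hjp, hjq, Ne.symm hij]
      · rw [not_or] at hi
        exact ⟨i, by simp [ε, hi.1, hi.2, hij]⟩
  refine hv.trace_eq_zero π (a := a) (b := b) (Subtype.ext ?_)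
  have hmove : ∀ c, b ≠ c → ∀ z, ι Q (v a) * ι Q (v b) * (ι Q (v c) * z) =
      (-ε a c) • (ι Q (v c) * (ι Q (v a) * ι Q (v b) * z)) := by
    intro c hbc z
    rw [mul_assoc, ← mul_assoc (ι Q (v b)), hv.anti b c hbc, ← mul_assoc, mul_neg, ← mul_assoc,
      hε a c]
    simp only [neg_smul, smul_mul_assoc, neg_mul, mul_assoc]
  simp only [MulMemClass.coe_mul, coe_evenProd, NegMemClass.coe_neg]
  have h := hmove p hb.2.2.1 1
  simp only [mul_one] at h
  rw [mul_assoc (ι Q (v i)), hmove i hb.1, hmove j hb.2.1, hmove q hb.2.2.2, h]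
  simp only [mul_smul_comm, smul_smul, mul_assoc]
  rw [← neg_one_smul k (ι Q (v i) * _)]
  congr 1
  linear_combination ha

/-- A representation of the even Clifford algebra is injective on the span of the products of two
vectors. -/
theorem eq_zero_of_map_eq_zero [FiniteDimensional k S] [Nontrivial S] (hd : 4 < d) {m : even Q}
    (hm : m ∈ Submodule.span k (Set.range fun p : V × V => evenProd Q p.1 p.2))
    (h0 : π m = 0) : m = 0 := by
  classical
  have hX : Submodule.span k (Set.range fun p : V × V => evenProd Q p.1 p.2) ≤
      Submodule.span k (Set.range fun p : Fin d × Fin d => evenProd Q (v p.1) (v p.2)) := by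
    have hspan : ∀ x, x ∈ Submodule.span k (Set.range v) := fun x => hv.span ▸ Submodule.mem_top
    rw [Submodule.span_le]
    rintro _ ⟨⟨x, y⟩, rfl⟩
    obtain ⟨a, rfl⟩ := (Submodule.mem_span_range_iff_exists_fun k).1 (hspan x)
    obtain ⟨b, rfl⟩ := (Submodule.mem_span_range_iff_exists_fun k).1 (hspan y)
    simp only [evenProd, map_sum, map_smul, LinearMap.sum_apply, LinearMap.smul_apply]
    exact sum_mem fun i _ => Submodule.smul_mem _ _ (sum_mem fun j _ =>
      Submodule.smul_mem _ _ (Submodule.subset_span ⟨(_, _), rfl⟩))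
  -- Taking the trace of π(m) against v_q v_p isolates c(p,q) - c(q,p), so `c` is symmetric. By
  -- anticommutation only the diagonal terms survive: `m` is a scalar, and scalars are detected by
  -- π.
  obtain ⟨c, rfl⟩ := (Submodule.mem_span_range_iff_exists_fun k).1 (hX hm)
  have hdim : LinearMap.trace k S 1 ≠ 0 := by
    rw [LinearMap.trace_one]
    exact Nat.cast_ne_zero.2 Module.finrank_pos.ne'
  have hsymm : ∀ p q, p ≠ q → c (p, q) = c (q, p) := by
    intro p q hpq
    have h1 : LinearMap.trace k S
        (π ((∑ x : Fin d × Fin d, c x • evenProd Q (v x.1) (v x.2)) * evenProd Q (v q) (v p))) =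
          0 := by
      rw [map_mul, h0, zero_mul, map_zero]
    have e1 : evenProd Q (v p) (v q) * evenProd Q (v q) (v p) = 1 := Subtype.ext (by
      simp only [MulMemClass.coe_mul, coe_evenProd, OneMemClass.coe_one]
      rw [mul_assoc, ← mul_assoc (ι Q (v q)), hv.sq, one_mul, hv.sq])
    have e2 : evenProd Q (v q) (v p) * evenProd Q (v q) (v p) = -1 := Subtype.ext (by
      simp only [MulMemClass.coe_mul, coe_evenProd, OneMemClass.coe_one, NegMemClass.coe_neg]
      conv_lhs => enter [1]; rw [hv.anti q p hpq.symm]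
      rw [neg_mul, mul_assoc, ← mul_assoc (ι Q (v q)), hv.sq, one_mul, hv.sq])
    simp only [Finset.sum_mul, map_sum, smul_mul_assoc, map_smul] at h1
    rw [Finset.sum_eq_add_of_mem (p, q) (q, p) (Finset.mem_univ _) (Finset.mem_univ _)
      (fun h => hpq (congrArg Prod.fst h))] at h1
    · simp only [e1, e2, map_neg, map_one, smul_eq_mul] at h1
      have h2 : (c (p, q) - c (q, p)) * LinearMap.trace k S 1 = 0 := by linear_combination h1
      exact sub_eq_zero.1 ((mul_eq_zero.1 h2).resolve_right hdim)
    · rintro ⟨i, j⟩ - ⟨hne1, hne2⟩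
      rw [hv.trace_mul_eq_zero π hd hpq (fun h => hne1 (Prod.ext h.1 h.2))
        (fun h => hne2 (Prod.ext h.1 h.2)), smul_zero]
  have hscalar : ∑ x : Fin d × Fin d, c x • evenProd Q (v x.1) (v x.2) =
      algebraMap k (even Q) (∑ i, c (i, i)) := by
    have h1 : ∀ i j, c (i, j) • evenProd Q (v i) (v j) + c (j, i) • evenProd Q (v j) (v i) =
        if i = j then algebraMap k (even Q) (2 * c (i, i)) else 0 := by
      intro i j
      split_ifs with hij
      · subst hij
        have : evenProd Q (v i) (v i) = 1 := Subtype.ext (hv.sq i)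
        rw [this, Algebra.algebraMap_eq_smul_one, two_mul, add_smul]
      · have : evenProd Q (v i) (v j) = -evenProd Q (v j) (v i) := Subtype.ext (hv.anti i j hij)
        rw [this, hsymm i j hij, smul_neg, neg_add_cancel]
    have h2 : (2 : k) • ∑ x : Fin d × Fin d, c x • evenProd Q (v x.1) (v x.2) =
        (2 : k) • algebraMap k (even Q) (∑ i, c (i, i)) := by
      rw [two_smul]
      simp only [Fintype.sum_prod_type]
      conv_lhs => enter [2]; rw [Finset.sum_comm]
      rw [← Finset.sum_add_distrib]
      simp only [← Finset.sum_add_distrib, h1, Finset.sum_ite_eq, Finset.mem_univ, if_true]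
      simp only [Algebra.algebraMap_eq_smul_one, mul_smul, Finset.smul_sum, Finset.sum_smul]
    exact smul_right_injective _ (two_ne_zero : (2 : k) ≠ 0) h2
  rw [hscalar] at h0 ⊢
  rw [AlgHom.commutes] at h0
  rw [(map_eq_zero_iff _ (algebraMap k (Module.End k S)).injective).1 h0, map_zero]

end IsOrthonormalGenerating

end TraceForm

/-! ### The orthogonal action of the spin group on V -/

section VectorRepresentation

open CliffordAlgebra

variable {k V : Type*} [Field k] [CharZero k] [AddCommGroup V] [Module k V]
variable (Q : QuadraticForm k V)

theorem CliffordAlgebra.ι_injective_of_charZero : Function.Injective (ι Q) := by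
  have : Invertible (2 : k) := invertibleOfNonzero two_ne_zero
  intro v w h
  have h1 := congrArg (equivExterior Q) h
  rw [equivExterior, changeFormEquiv_apply, changeFormEquiv_apply, changeForm_ι,
    changeForm_ι] at h1
  exact ExteriorAlgebra.ι_inj k v w |>.1 h1

theorem CliffordAlgebra.nontrivial_of_charZero : Nontrivial (CliffordAlgebra Q) :=
  have : Invertible (2 : k) := invertibleOfNonzero two_ne_zero
  inferInstance

variable {Q} in
theorem spinGroup.conj_ι_mem_range (x : spinGroup Q) (v : V) :
    (x : CliffordAlgebra Q) * ι Q v * (x⁻¹ : spinGroup Q) ∈ LinearMap.range (ι Q) := by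
  have : Invertible (2 : k) := invertibleOfNonzero two_ne_zero
  exact spinGroup.conjAct_smul_ι_mem_range_ι (x := spinGroup.toUnits x) x.2 v

variable {Q} in
omit [CharZero k] in
theorem spinGroup.coe_mul_inv (x : spinGroup Q) :
    (x : CliffordAlgebra Q) * (x⁻¹ : spinGroup Q) = 1 := spinGroup.coe_mul_star_self x

variable {Q} in
omit [CharZero k] in
theorem spinGroup.coe_inv_mul (x : spinGroup Q) :
    ((x⁻¹ : spinGroup Q) : CliffordAlgebra Q) * x = 1 := spinGroup.coe_star_mul_self x

/-- The action of the spin group on vectors by conjugation. -/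
noncomputable def vectorAction (x : spinGroup Q) : V →ₗ[k] V :=
  (LinearEquiv.ofInjective (ι Q) (ι_injective_of_charZero Q)).symm.toLinearMap ∘ₗ
    LinearMap.codRestrict (LinearMap.range (ι Q))
      (LinearMap.mulRight k ((x⁻¹ : spinGroup Q) : CliffordAlgebra Q) ∘ₗ
        LinearMap.mulLeft k (x : CliffordAlgebra Q) ∘ₗ ι Q) (spinGroup.conj_ι_mem_range x)

variable {Q}

theorem ι_vectorAction (x : spinGroup Q) (v : V) :
    ι Q (vectorAction Q x v) = x * ι Q v * (x⁻¹ : spinGroup Q) := by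
  have := congrArg Subtype.val ((LinearEquiv.ofInjective (ι Q)
    (ι_injective_of_charZero Q)).apply_symm_apply ⟨_, spinGroup.conj_ι_mem_range x v⟩)
  exact this

theorem ι_vectorAction_mul (x : spinGroup Q) (v : V) :
    ι Q (vectorAction Q x v) * x = x * ι Q v := by
  rw [ι_vectorAction, mul_assoc, spinGroup.coe_inv_mul, mul_one]

theorem vectorAction_eq {x : spinGroup Q} {v w : V}
    (h : (x : CliffordAlgebra Q) * ι Q v = ι Q w * x) : vectorAction Q x v = w := by
  apply ι_injective_of_charZero Q
  rw [ι_vectorAction, h, mul_assoc, spinGroup.coe_mul_inv, mul_one]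

theorem vectorAction_mul (x y : spinGroup Q) :
    vectorAction Q (x * y) = vectorAction Q x * vectorAction Q y := by
  refine LinearMap.ext fun v => vectorAction_eq ?_
  rw [Module.End.mul_apply, Submonoid.coe_mul, ← mul_assoc, ι_vectorAction_mul, mul_assoc,
    mul_assoc, ι_vectorAction_mul]

theorem vectorAction_one : vectorAction Q (1 : spinGroup Q) = 1 :=
  LinearMap.ext fun v => vectorAction_eq (by simp)

theorem vectorAction_pow (x : spinGroup Q) (m : ℕ) :
    vectorAction Q (x ^ m) = vectorAction Q x ^ m := by
  induction m with
  | zero => rw [pow_zero, pow_zero, vectorAction_one]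
  | succ m ih => rw [pow_succ, pow_succ, vectorAction_mul, ih]

theorem polar_vectorAction (x : spinGroup Q) (v w : V) :
    QuadraticMap.polar Q (vectorAction Q x v) (vectorAction Q x w) = QuadraticMap.polar Q v w := by
  have := nontrivial_of_charZero Q
  apply (algebraMap k (CliffordAlgebra Q)).injective
  have h : ∀ a b, ι Q (vectorAction Q x a) * ι Q (vectorAction Q x b) =
      x * (ι Q a * ι Q b) * (x⁻¹ : spinGroup Q) := by
    intro a b
    rw [ι_vectorAction x b, ← mul_assoc, ← mul_assoc, ι_vectorAction_mul]
    simp only [mul_assoc]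
  rw [← ι_mul_ι_add_swap, ← ι_mul_ι_add_swap, h, h, ← add_mul, ← mul_add, ι_mul_ι_add_swap,
    ← Algebra.commutes, mul_assoc, spinGroup.coe_mul_inv, mul_one]

end VectorRepresentation

/-! ### Joint refinement of commuting idempotents -/

section JointIdempotents

variable {k A : Type*} [Field k] [Ring A] [Algebra k A]

open scoped IsMulCommutative in
/-- Commuting idempotents have a common refinement to a complete family of orthogonal
idempotents. -/
theorem exists_joint_idempotents {n : ℕ} {P : Fin n → A} (hP : ∀ i, P i * P i = P i)
    (hc : ∀ i j, P i * P j = P j * P i) :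
    ∃ E : (Fin n → Bool) → A, CompleteOrthogonalIdempotents E ∧
      ∀ i ε, P i * E ε = if ε i then E ε else 0 := by
  classical
  have := Algebra.isMulCommutative_adjoin ℤ (s := Set.range P) (by
    rintro _ ⟨i, rfl⟩ _ ⟨j, rfl⟩
    exact hc i j)
  let D := Algebra.adjoin ℤ (Set.range P)
  let p : Fin n → D := fun i => ⟨P i, Algebra.subset_adjoin ⟨i, rfl⟩⟩
  have hp : ∀ i, p i * p i = p i := fun i => Subtype.ext (hP i)
  -- The refinement consists of the products over `i` of P i or 1 - P i, formed in the commutative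
  -- subring generated by the P i.
  let q : Fin n → Bool → D := fun i b => if b then p i else 1 - p i
  have hq : ∀ i b b', q i b * q i b' = if b = b' then q i b else 0 := by
    intro i b b'
    cases b <;> cases b' <;> simp [q, mul_sub, sub_mul, hp]
  let e : (Fin n → Bool) → D := fun ε => ∏ i, q i (ε i)
  have hidem : ∀ ε, e ε * e ε = e ε := fun ε => by
    simp only [e, ← Finset.prod_mul_distrib, hq, if_true]
  have horth : ∀ ε ε', ε ≠ ε' → e ε * e ε' = 0 := by
    intro ε ε' h
    obtain ⟨i, hi⟩ := Function.ne_iff.1 h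
    simp only [e, ← Finset.prod_mul_distrib]
    exact Finset.prod_eq_zero (Finset.mem_univ i) (by rw [hq, if_neg hi])
  have hsum : ∑ ε, e ε = 1 := by
    have := Finset.prod_univ_sum (fun _ : Fin n => (Finset.univ : Finset Bool)) q
    rw [Fintype.piFinset_univ] at this
    simp only [e]
    rw [← this]
    simp [q]
  have hpe : ∀ i ε, p i * e ε = if ε i then e ε else 0 := by
    intro i ε
    simp only [e]
    rw [← Finset.mul_prod_erase _ _ (Finset.mem_univ i), ← mul_assoc]
    have : p i * q i (ε i) = if ε i then q i (ε i) else 0 := by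
      cases ε i <;> simp [q, mul_sub, hp]
    rw [this]
    split_ifs <;> simp
  refine ⟨fun ε => e ε, ⟨⟨fun ε => congrArg Subtype.val (hidem ε),
    fun ε ε' h => congrArg Subtype.val (horth ε ε' h)⟩, ?_⟩, fun i ε => ?_⟩
  · have := congrArg Subtype.val hsum
    rw [AddSubmonoidClass.coe_finsetSum] at this
    exact this
  · have := congrArg Subtype.val (hpe i ε)
    split_ifs at this ⊢ <;> exact this

end JointIdempotents

/-! ### The torus of the spin group attached to a hyperbolic basis -/

section SpinTorus

open CliffordAlgebra

variable {k V : Type*} [Field k] [CharZero k] [AddCommGroup V] [Module k V]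

/-- A basis `e₁, …, eₙ, f₁, …, fₙ` of a quadratic space in which the polar form is a sum of
hyperbolic planes. -/
structure IsHyperbolicBasis {n : ℕ} (Q : QuadraticForm k V) (e f : Fin n → V) : Prop where
  ee : ∀ i j, QuadraticMap.polar Q (e i) (e j) = 0
  ff : ∀ i j, QuadraticMap.polar Q (f i) (f j) = 0
  ef : ∀ i j, QuadraticMap.polar Q (e i) (f j) = if i = j then 1 else 0
  expand : ∀ v, v = ∑ i, (QuadraticMap.polar Q v (f i) • e i + QuadraticMap.polar Q v (e i) • f i)

omit [CharZero k] in
theorem unitsOfCoords_induction {n : ℕ} {p : (Fin n → k)ˣ → Prop} (h1 : p 1)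
    (hmul : ∀ s t, p s → p t → p (s * t))
    (hsingle : ∀ i c, p (unitsOfCoords (Pi.mulSingle i c))) (t : (Fin n → k)ˣ) : p t := by
  have ht : t = ∏ i, unitsOfCoords (Pi.mulSingle i (coordChar i t)) := by
    conv_lhs => rw [← unitsOfCoords_coordChar t, ← Finset.univ_prod_mulSingle
      (fun j => coordChar j t)]
    exact map_prod (MulEquiv.piUnits.symm : (Fin n → kˣ) ≃* (Fin n → k)ˣ) _ _
  rw [ht]
  exact Finset.prod_induction _ p hmul h1 fun i _ => hsingle i _

namespace IsHyperbolicBasis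

variable {n : ℕ} {Q : QuadraticForm k V} {e f : Fin n → V} (h : IsHyperbolicBasis Q e f)

include h

omit [CharZero k] in
theorem e_mul_e (i j : Fin n) : ι Q (e i) * ι Q (e j) = -(ι Q (e j) * ι Q (e i)) := by
  have := ι_mul_ι_add_swap (Q := Q) (e i) (e j)
  rw [h.ee, map_zero] at this
  exact eq_neg_of_add_eq_zero_left this

omit [CharZero k] in
theorem f_mul_f (i j : Fin n) : ι Q (f i) * ι Q (f j) = -(ι Q (f j) * ι Q (f i)) := by
  have := ι_mul_ι_add_swap (Q := Q) (f i) (f j)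
  rw [h.ff, map_zero] at this
  exact eq_neg_of_add_eq_zero_left this

theorem e_sq (i : Fin n) : ι Q (e i) * ι Q (e i) = 0 := by
  have h1 := h.e_mul_e i i
  have h2 : (2 : k) • (ι Q (e i) * ι Q (e i)) = 0 := by
    rw [two_smul]; nth_rewrite 1 [h1]; exact neg_add_cancel _
  exact (smul_eq_zero.1 h2).resolve_left two_ne_zero

theorem f_sq (i : Fin n) : ι Q (f i) * ι Q (f i) = 0 := by
  have h1 := h.f_mul_f i i
  have h2 : (2 : k) • (ι Q (f i) * ι Q (f i)) = 0 := by
    rw [two_smul]; nth_rewrite 1 [h1]; exact neg_add_cancel _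
  exact (smul_eq_zero.1 h2).resolve_left two_ne_zero

omit [CharZero k] in
theorem f_mul_e (i : Fin n) : ι Q (f i) * ι Q (e i) = 1 - ι Q (e i) * ι Q (f i) := by
  have := ι_mul_ι_add_swap (Q := Q) (e i) (f i)
  rw [h.ef, if_pos rfl, map_one] at this
  exact eq_sub_of_add_eq' this

omit [CharZero k] in
theorem e_mul_f {i j : Fin n} (hij : i ≠ j) :
    ι Q (e i) * ι Q (f j) = -(ι Q (f j) * ι Q (e i)) := by
  have := ι_mul_ι_add_swap (Q := Q) (e i) (f j)
  rw [h.ef, if_neg hij, map_zero] at this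
  exact eq_neg_of_add_eq_zero_left this

theorem e_f_e (i : Fin n) : ι Q (e i) * ι Q (f i) * ι Q (e i) = ι Q (e i) := by
  rw [mul_assoc, h.f_mul_e, mul_sub, ← mul_assoc, h.e_sq, zero_mul, mul_one, sub_zero]

theorem f_e_f (i : Fin n) : ι Q (f i) * (ι Q (e i) * ι Q (f i)) = ι Q (f i) := by
  rw [← mul_assoc, h.f_mul_e, sub_mul, mul_assoc, h.f_sq, mul_zero, one_mul, sub_zero]

theorem e_e_f (i : Fin n) : ι Q (e i) * (ι Q (e i) * ι Q (f i)) = 0 := by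
  rw [← mul_assoc, h.e_sq, zero_mul]

theorem e_f_f (i : Fin n) : ι Q (e i) * ι Q (f i) * ι Q (f i) = 0 := by
  rw [mul_assoc, h.f_sq, mul_zero]

omit [CharZero k] in
theorem commute_e {i j : Fin n} (hij : i ≠ j) :
    Commute (ι Q (e i) * ι Q (f i)) (ι Q (e j)) := by
  rw [Commute, SemiconjBy, mul_assoc, ← neg_eq_iff_eq_neg.2 (h.e_mul_f hij.symm), mul_neg,
    ← mul_assoc, h.e_mul_e i j, neg_mul, neg_neg, mul_assoc]

omit [CharZero k] in
theorem commute_f {i j : Fin n} (hij : i ≠ j) :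
    Commute (ι Q (e i) * ι Q (f i)) (ι Q (f j)) := by
  rw [Commute, SemiconjBy, mul_assoc, h.f_mul_f i j, mul_neg, ← mul_assoc, h.e_mul_f hij, neg_mul,
    neg_neg, mul_assoc]

theorem proj_sq (i : Fin n) :
    evenProd Q (e i) (f i) * evenProd Q (e i) (f i) = evenProd Q (e i) (f i) :=
  Subtype.ext (by
    simp only [MulMemClass.coe_mul, coe_evenProd]
    rw [← mul_assoc, h.e_f_e])

omit [CharZero k] in
theorem proj_comm (i j : Fin n) : evenProd Q (e i) (f i) * evenProd Q (e j) (f j) =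
    evenProd Q (e j) (f j) * evenProd Q (e i) (f i) := by
  by_cases hij : i = j
  · rw [hij]
  · exact Subtype.ext ((h.commute_e hij).mul_right (h.commute_f hij))

/-- The weight idempotents in the even Clifford algebra. -/
noncomputable def weightIdem : (Fin n → Bool) → even Q :=
  (exists_joint_idempotents h.proj_sq h.proj_comm).choose

theorem weightIdem_complete : CompleteOrthogonalIdempotents h.weightIdem :=
  (exists_joint_idempotents h.proj_sq h.proj_comm).choose_spec.1

theorem proj_mul_weightIdem (i : Fin n) (ε : Fin n → Bool) :
    evenProd Q (e i) (f i) * h.weightIdem ε = if ε i then h.weightIdem ε else 0 :=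
  (exists_joint_idempotents h.proj_sq h.proj_comm).choose_spec.2 i ε

omit h in
/-- The exponents of the weights of the spin representation, in coordinates on a double cover of
the maximal torus of the spin group. -/
def spinWeight (ε : Fin n → Bool) : Fin n → ℤ := fun i => if ε i then 1 else -1

/-- The parametrization of the torus of the spin group, as units of the even Clifford algebra. -/
noncomputable def torusUnits : (Fin n → k)ˣ →* (even Q)ˣ :=
  diagonalHom h.weightIdem_complete fun ε => monomialChar (spinWeight ε)

/-- The element with one nontrivial coordinate involves only the idempotent eᵢfᵢ. Such elements
generate the torus, so properties of the parametrization need checking only on them. -/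
theorem torusUnits_single (i : Fin n) (c : kˣ) :
    ((h.torusUnits (unitsOfCoords (Pi.mulSingle i c)) : even Q) : CliffordAlgebra Q) =
      (c : k) • (ι Q (e i) * ι Q (f i)) + ((c⁻¹ : kˣ) : k) • (1 - ι Q (e i) * ι Q (f i)) := by
  have h1 : evenProd Q (e i) (f i) = ∑ ε, if ε i then h.weightIdem ε else 0 := by
    rw [← mul_one (evenProd Q (e i) (f i)), ← h.weightIdem_complete.complete, Finset.mul_sum]
    simp only [h.proj_mul_weightIdem]
  have h2 : ∀ ε : Fin n → Bool, monomialChar (spinWeight ε) (unitsOfCoords (Pi.mulSingle i c)) =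
      if ε i then c else c⁻¹ := by
    intro ε
    rw [monomialChar_apply, Finset.prod_eq_single i]
    · simp only [coordChar_unitsOfCoords, Pi.mulSingle_eq_same, spinWeight]
      split_ifs <;> simp
    · intro j _ hj
      simp [coordChar_unitsOfCoords, Pi.mulSingle_eq_of_ne hj]
    · simp
  have h3 : (h.torusUnits (unitsOfCoords (Pi.mulSingle i c)) : even Q) =
      (c : k) • evenProd Q (e i) (f i) + ((c⁻¹ : kˣ) : k) • (1 - evenProd Q (e i) (f i)) := by
    rw [torusUnits, diagonalHom_val, h1]
    rw [← h.weightIdem_complete.complete]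
    rw [← Finset.sum_sub_distrib, Finset.smul_sum, Finset.smul_sum, ← Finset.sum_add_distrib]
    refine Finset.sum_congr rfl fun ε _ => ?_
    rw [h2]
    split_ifs <;> simp
  rw [h3]
  simp

theorem isUnit_e_add_f (i : Fin n) (c : kˣ) :
    ι Q (((c⁻¹ : kˣ) : k) • e i + (c : k) • f i) * ι Q (((c⁻¹ : kˣ) : k) • e i + (c : k) • f i) =
      1 := by
  simp only [map_add, map_smul, mul_add, add_mul, smul_mul_smul_comm, h.e_sq, h.f_sq, smul_zero,
    h.f_mul_e]
  simp

theorem torusUnits_single_mem (i : Fin n) (c : kˣ) :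
    ((h.torusUnits (unitsOfCoords (Pi.mulSingle i c)) : even Q) : CliffordAlgebra Q) ∈
      spinGroup Q := by
  -- The torus element is the product of the two vectors `a` and `b`, each with Clifford square 1;
  -- hence it is even, and reversing the product inverts it.
  set a := e i + f i with ha
  set b := ((c⁻¹ : kˣ) : k) • e i + (c : k) • f i with hb
  have hbb : ι Q b * ι Q b = 1 := h.isUnit_e_add_f i c
  have haa : ι Q a * ι Q a = 1 := by
    have := h.isUnit_e_add_f i 1
    rwa [inv_one, Units.val_one, one_smul, one_smul] at this
  have hprod : ((h.torusUnits (unitsOfCoords (Pi.mulSingle i c)) : even Q) : CliffordAlgebra Q) =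
      ι Q a * ι Q b := by
    rw [torusUnits_single, ha, hb]
    simp only [map_add, map_smul, mul_add, add_mul, mul_smul_comm, h.e_sq, h.f_sq, h.f_mul_e]
    simp [add_comm]
  have hstar : star (ι Q a * ι Q b) = ι Q b * ι Q a := by
    rw [star_mul]; simp [star_ι]
  refine ⟨⟨?_, ?_⟩, (h.torusUnits _ : even Q).2⟩
  · rw [hprod]
    refine ⟨⟨ι Q a, ι Q a, haa, haa⟩ * ⟨ι Q b, ι Q b, hbb, hbb⟩, mul_mem ?_ ?_, rfl⟩
    · exact Subgroup.subset_closure ⟨a, rfl⟩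
    · exact Subgroup.subset_closure ⟨b, rfl⟩
  · change _ ∈ unitary _
    rw [hprod, Unitary.mem_iff, hstar]
    constructor
    · rw [mul_assoc, ← mul_assoc (ι Q a), haa, one_mul, hbb]
    · rw [mul_assoc, ← mul_assoc (ι Q b), hbb, one_mul, haa]

theorem torusUnits_mem (t : (Fin n → k)ˣ) :
    ((h.torusUnits t : even Q) : CliffordAlgebra Q) ∈ spinGroup Q := by
  refine unitsOfCoords_induction (p := fun t => ((h.torusUnits t : even Q) : CliffordAlgebra Q) ∈
    spinGroup Q) ?_ (fun s t hs ht => ?_) h.torusUnits_single_mem t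
  · rw [map_one]; exact one_mem _
  · rw [map_mul]; exact mul_mem hs ht

/-- The parametrization of the torus of the spin group attached to a hyperbolic basis. -/
noncomputable def spinTorus : (Fin n → k)ˣ →* spinGroup Q where
  toFun t := ⟨(h.torusUnits t : even Q), h.torusUnits_mem t⟩
  map_one' := Subtype.ext
    (congrArg (fun u : (even Q)ˣ => ((u : even Q) : CliffordAlgebra Q)) (map_one h.torusUnits))
  map_mul' s t := Subtype.ext
    (congrArg (fun u : (even Q)ˣ => ((u : even Q) : CliffordAlgebra Q)) (map_mul h.torusUnits s t))

theorem spinTorus_single (i : Fin n) (c : kˣ) :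
    (h.spinTorus (unitsOfCoords (Pi.mulSingle i c)) : CliffordAlgebra Q) =
      (c : k) • (ι Q (e i) * ι Q (f i)) + ((c⁻¹ : kˣ) : k) • (1 - ι Q (e i) * ι Q (f i)) :=
  h.torusUnits_single i c

/-- The square on the coordinate shows that the parametrization is in coordinates whose squares are
the eigenvalues on V; this is why spinor weights have integral exponents ±1. -/
theorem spinTorus_mul_e (t : (Fin n → k)ˣ) (i : Fin n) :
    (h.spinTorus t : CliffordAlgebra Q) * ι Q (e i) =
      ((coordChar i t ^ 2 : kˣ) : k) • (ι Q (e i) * h.spinTorus t) := by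
  refine unitsOfCoords_induction (p := fun t => (h.spinTorus t : CliffordAlgebra Q) * ι Q (e i) =
      ((coordChar i t ^ 2 : kˣ) : k) • (ι Q (e i) * h.spinTorus t)) ?_ (fun s t hs ht => ?_)
      (fun j c => ?_) t
  · simp
  · rw [map_mul, Submonoid.coe_mul, mul_assoc, ht, mul_smul_comm, ← mul_assoc, hs, smul_mul_assoc,
      smul_smul, mul_assoc, map_mul, mul_pow, Units.val_mul, mul_comm ((coordChar i t ^ 2 : kˣ) : k)]
  · rw [spinTorus_single]
    by_cases hij : j = i
    · subst hij
      rw [add_mul, smul_mul_assoc, h.e_f_e, smul_mul_assoc, sub_mul, h.e_f_e, one_mul, sub_self,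
        smul_zero, mul_add, mul_smul_comm, h.e_e_f, mul_smul_comm, mul_sub, h.e_e_f]
      simp [smul_smul, pow_two]
    · have := (h.commute_e hij).eq
      simp [Pi.mulSingle_eq_of_ne (Ne.symm hij), add_mul, mul_add, sub_mul, mul_sub, this]

theorem spinTorus_mul_f (t : (Fin n → k)ˣ) (i : Fin n) :
    (h.spinTorus t : CliffordAlgebra Q) * ι Q (f i) =
      (((coordChar i t ^ 2)⁻¹ : kˣ) : k) • (ι Q (f i) * h.spinTorus t) := by
  refine unitsOfCoords_induction (p := fun t => (h.spinTorus t : CliffordAlgebra Q) * ι Q (f i) =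
      (((coordChar i t ^ 2)⁻¹ : kˣ) : k) • (ι Q (f i) * h.spinTorus t)) ?_ (fun s t hs ht => ?_)
      (fun j c => ?_) t
  · simp
  · rw [map_mul, Submonoid.coe_mul, mul_assoc, ht, mul_smul_comm, ← mul_assoc, hs, smul_mul_assoc,
      smul_smul, mul_assoc, map_mul, mul_pow, mul_inv, Units.val_mul,
      mul_comm (((coordChar i t ^ 2)⁻¹ : kˣ) : k)]
  · rw [spinTorus_single]
    by_cases hij : j = i
    · subst hij
      rw [add_mul, smul_mul_assoc, h.e_f_f, smul_mul_assoc, sub_mul, h.e_f_f, one_mul, smul_zero,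
        zero_add, sub_zero, mul_add, mul_smul_comm, h.f_e_f, mul_smul_comm, mul_sub, h.f_e_f]
      simp [smul_smul, pow_two]
    · have := (h.commute_f hij).eq
      simp [Pi.mulSingle_eq_of_ne (Ne.symm hij), add_mul, mul_add, sub_mul, mul_sub, this]

end IsHyperbolicBasis

end SpinTorus

/-! ### Diagonal characters on the image of a diagonal representation -/

section DiagonalCharacters

variable {k : Type*} [Field k] {A : Type*} [Ring A] [Algebra k A]
variable {ι : Type*} [Fintype ι]

/-- The diagonal characters of a diagonal representation descend to algebraic characters of its
image. -/
theorem exists_character_diagonalHom {E : ι → A} (hE : CompleteOrthogonalIdempotents E)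
    {G : Type*} [Group G] (χ : ι → G →* kˣ) (i : ι) (hi : E i ≠ 0) :
    ∃ x : CharacterLattice k (diagonalHom hE χ).range,
      ∀ g, (x : Additive ((diagonalHom hE χ).range →* kˣ)).toMul ⟨diagonalHom hE χ g, g, rfl⟩ =
        χ i g := by
  obtain ⟨l, hl⟩ := exists_dual_apply_diagonalHom hE χ i hi
  let f : (diagonalHom hE χ).range →* k :=
    { toFun x := l ((x : Aˣ) : A)
      map_one' := by
        have := hl 1
        rw [map_one, map_one] at this
        exact this
      map_mul' := by
        rintro ⟨_, g, rfl⟩ ⟨_, g', rfl⟩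
        have := hl (g * g')
        simp only [map_mul, Units.val_mul, ← hl] at this
        exact this }
  refine ⟨⟨Additive.ofMul f.toHomUnits, fun l' => ?_⟩, fun g => Units.ext (hl g)⟩
  have h1 := Subalgebra.smul_mem _ (dual_mem_regularFunctions (diagonalHom hE χ).range.subtype l)
    (l' 1)
  refine mem_regularFunctions.1 ?_
  convert h1 using 1
  funext x
  have : ((f.toHomUnits x : kˣ) : k) = l ((x : Aˣ) : A) := rfl
  simp only [toMul_ofMul, MonoidHom.id_apply, this, Pi.smul_apply, smul_eq_mul]
  conv_lhs => rw [← mul_one (l ((x : Aˣ) : A)), ← smul_eq_mul, map_smul, smul_eq_mul, mul_comm]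
  rfl

end DiagonalCharacters

/-! ### Centralizers of hyperbolic planes and the torus of the half-spin group -/

section HalfSpinTorus

open CliffordAlgebra

variable {k V : Type*} [Field k] [CharZero k] [AddCommGroup V] [Module k V]
variable {Q : QuadraticForm k V}

/-- The inclusion of the spin group in the even Clifford algebra. -/
def spinToEven : spinGroup Q →* even Q where
  toFun x := ⟨x, x.2.2⟩
  map_one' := rfl
  map_mul' _ _ := rfl

omit [CharZero k] in
@[simp]
theorem coe_spinToEven (x : spinGroup Q) :
    (spinToEven x : CliffordAlgebra Q) = x := rfl

theorem spinToEven_conj_evenProd (x : spinGroup Q) (v w : V) :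
    spinToEven x * evenProd Q v w = evenProd Q (vectorAction Q x v) (vectorAction Q x w) *
      spinToEven x := by
  refine Subtype.ext ?_
  simp only [MulMemClass.coe_mul, coe_evenProd, coe_spinToEven]
  rw [mul_assoc, ι_vectorAction_mul, ← mul_assoc, ← mul_assoc, ι_vectorAction_mul]

/-- An element of the spin group commutes with a product of two vectors if it does so in a
representation of the even Clifford algebra. -/
theorem spinToEven_commute_evenProd {d : ℕ} {b : Fin d → V} (hb : IsOrthonormalGenerating Q b)
    (hd : 4 < d) {S : Type*} [AddCommGroup S] [Module k S] [FiniteDimensional k S] [Nontrivial S]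
    (π : even Q →ₐ[k] Module.End k S) {x : spinGroup Q} {v w : V}
    (h : π (spinToEven x) * π (evenProd Q v w) = π (evenProd Q v w) * π (spinToEven x)) :
    spinToEven x * evenProd Q v w = evenProd Q v w * spinToEven x := by
  have hx : spinToEven x * spinToEven x⁻¹ = 1 := by rw [← map_mul, mul_inv_cancel, map_one]
  have h1 : evenProd Q (vectorAction Q x v) (vectorAction Q x w) - evenProd Q v w = 0 := by
    refine hb.eq_zero_of_map_eq_zero π hd (sub_mem (Submodule.subset_span ⟨(_, _), rfl⟩)
      (Submodule.subset_span ⟨(_, _), rfl⟩)) ?_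
    have h2 : π (evenProd Q (vectorAction Q x v) (vectorAction Q x w)) * π (spinToEven x) =
        π (evenProd Q v w) * π (spinToEven x) := by
      rw [← map_mul, ← spinToEven_conj_evenProd, map_mul, h]
    have h3 := congrArg (· * π (spinToEven x⁻¹)) h2
    simp only [mul_assoc, ← map_mul, hx, mul_one] at h3
    rw [map_sub, h3, sub_self]
  rw [spinToEven_conj_evenProd, sub_eq_zero.1 h1]

namespace IsHyperbolicBasis

variable {n : ℕ} {e f : Fin n → V} (h : IsHyperbolicBasis Q e f)

include h

omit [CharZero k] h in
theorem proj_bracket (i : Fin n) (v : V) :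
    ι Q (e i) * ι Q (f i) * ι Q v - ι Q v * (ι Q (e i) * ι Q (f i)) =
      QuadraticMap.polar Q v (f i) • ι Q (e i) - QuadraticMap.polar Q v (e i) • ι Q (f i) := by
  have h1 := ι_mul_ι_add_swap (Q := Q) v (f i)
  have h2 := ι_mul_ι_add_swap (Q := Q) v (e i)
  rw [Algebra.algebraMap_eq_smul_one] at h1 h2
  have h3 : ι Q (f i) * ι Q v = QuadraticMap.polar Q v (f i) • 1 - ι Q v * ι Q (f i) :=
    eq_sub_of_add_eq' h1
  have h4 : ι Q (e i) * ι Q v = QuadraticMap.polar Q v (e i) • 1 - ι Q v * ι Q (e i) :=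
    eq_sub_of_add_eq' h2
  rw [mul_assoc, h3, mul_sub, ← mul_assoc (ι Q (e i)), h4, sub_mul]
  simp only [mul_smul_comm, smul_mul_assoc, mul_one, one_mul, mul_assoc]
  abel

/-- The elements of the spin group commuting with the hyperbolic planes of a hyperbolic basis
act diagonally on the basis. -/
theorem exists_vectorAction_eq_smul {y : spinGroup Q} {i : Fin n}
    (hy : spinToEven y * evenProd Q (e i) (f i) = evenProd Q (e i) (f i) * spinToEven y) :
    ∃ a : kˣ, vectorAction Q y (e i) = (a : k) • e i ∧
      vectorAction Q y (f i) = ((a⁻¹ : kˣ) : k) • f i := by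
  have hy' : (y : CliffordAlgebra Q) * (ι Q (e i) * ι Q (f i)) = ι Q (e i) * ι Q (f i) * y :=
    congrArg Subtype.val hy
  have hcancel : ∀ {a b : CliffordAlgebra Q}, a * y = b * y → a = b := by
    intro a b hab
    have := congrArg (· * ((y⁻¹ : spinGroup Q) : CliffordAlgebra Q)) hab
    simpa only [mul_assoc, spinGroup.coe_mul_inv, mul_one] using this
  have hE := ι_vectorAction_mul y (e i)
  have hF := ι_vectorAction_mul y (f i)
  -- With P = eᵢfᵢ, the relations Pv = v and vP = 0 single out the multiples of eᵢ among vectors,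
  -- while Pv = 0 and vP = v single out those of fᵢ. Conjugation by `y` fixes P and so preserves
  -- both lines.
  have e1 : ι Q (e i) * ι Q (f i) * ι Q (vectorAction Q y (e i)) = ι Q (vectorAction Q y (e i)) :=
    hcancel (by rw [mul_assoc, hE, ← mul_assoc, ← hy', mul_assoc, h.e_f_e])
  have e2 : ι Q (vectorAction Q y (e i)) * (ι Q (e i) * ι Q (f i)) = 0 :=
    hcancel (by rw [mul_assoc, ← hy', ← mul_assoc, hE, mul_assoc, h.e_e_f, mul_zero, zero_mul])
  have f1 : ι Q (e i) * ι Q (f i) * ι Q (vectorAction Q y (f i)) = 0 :=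
    hcancel (by rw [mul_assoc, hF, ← mul_assoc, ← hy', mul_assoc, h.e_f_f, mul_zero, zero_mul])
  have f2 : ι Q (vectorAction Q y (f i)) * (ι Q (e i) * ι Q (f i)) =
      ι Q (vectorAction Q y (f i)) :=
    hcancel (by rw [mul_assoc, ← hy', ← mul_assoc, hF, mul_assoc, h.f_e_f])
  have he : vectorAction Q y (e i) =
      QuadraticMap.polar Q (vectorAction Q y (e i)) (f i) • e i := by
    have h1 := proj_bracket (Q := Q) (e := e) (f := f) i (vectorAction Q y (e i))
    rw [e1, e2, sub_zero] at h1
    have h2 := e1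
    rw [h1, mul_sub, mul_smul_comm, mul_smul_comm, h.e_f_e, h.e_f_f, smul_zero, sub_zero,
      ← h1, ← map_smul] at h2
    exact (ι_injective_of_charZero Q h2).symm
  have hf : vectorAction Q y (f i) =
      QuadraticMap.polar Q (vectorAction Q y (f i)) (e i) • f i := by
    have h1 := proj_bracket (Q := Q) (e := e) (f := f) i (vectorAction Q y (f i))
    rw [f1, f2, zero_sub, neg_eq_iff_eq_neg] at h1
    have h2 := f2
    rw [h1, neg_sub, sub_mul, smul_mul_assoc, smul_mul_assoc, h.e_e_f, h.f_e_f, smul_zero,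
      sub_zero, ← neg_sub, ← h1, ← map_smul] at h2
    exact (ι_injective_of_charZero Q h2).symm
  set a := QuadraticMap.polar Q (vectorAction Q y (e i)) (f i)
  set b := QuadraticMap.polar Q (vectorAction Q y (f i)) (e i)
  have hab : a * b = 1 := by
    have h1 := polar_vectorAction y (e i) (f i)
    rw [he, hf, QuadraticMap.polar_smul_left, QuadraticMap.polar_smul_right, h.ef, if_pos rfl] at h1
    simpa using h1
  exact ⟨⟨a, b, hab, by rw [mul_comm, hab]⟩, he, hf⟩

omit [CharZero k] in
theorem vectorAction_ext {g g' : V →ₗ[k] V} (he : ∀ i, g (e i) = g' (e i))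
    (hf : ∀ i, g (f i) = g' (f i)) : g = g' := by
  refine LinearMap.ext fun v => ?_
  rw [h.expand v]
  simp only [map_sum, map_add, map_smul, he, hf]

/-- The centralizer in the spin group of the hyperbolic planes of a hyperbolic basis is the
torus attached to the basis. -/
theorem mem_range_spinTorus [IsAlgClosed k] {d : ℕ} {b : Fin d → V}
    (hb : IsOrthonormalGenerating Q b) (hn : 0 < n) {y : spinGroup Q}
    (hy : ∀ i, spinToEven y * evenProd Q (e i) (f i) = evenProd Q (e i) (f i) * spinToEven y) :
    ∃ t, h.spinTorus t = y := by
  have := nontrivial_of_charZero Q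
  choose a hae haf using fun i => h.exists_vectorAction_eq_smul (hy i)
  -- The torus acts on eᵢ through the square of its coordinate, so matching the eigenvalues of `y`
  -- requires square roots.
  have hroot : ∀ i, ∃ c : kˣ, c ^ 2 = a i := by
    intro i
    obtain ⟨z, hz⟩ := IsAlgClosed.exists_pow_nat_eq (a i : k) (Nat.succ_pos 1)
    have hz0 : z ≠ 0 := by
      rintro rfl
      rw [zero_pow (Nat.succ_ne_zero 1)] at hz
      exact (a i).ne_zero hz.symm
    exact ⟨Units.mk0 z hz0, Units.ext (by simpa using hz)⟩
  choose c hc using hroot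
  set t := unitsOfCoords c
  have hact : vectorAction Q y = vectorAction Q (h.spinTorus t) := by
    refine h.vectorAction_ext (fun i => ?_) fun i => ?_
    · rw [hae, vectorAction_eq (w := (a i : k) • e i)]
      rw [h.spinTorus_mul_e, coordChar_unitsOfCoords, hc, map_smul, smul_mul_assoc]
    · rw [haf, vectorAction_eq (w := ((a i)⁻¹ : kˣ) • f i)]
      · rfl
      · rw [h.spinTorus_mul_f, coordChar_unitsOfCoords, hc, Units.smul_def, map_smul,
          smul_mul_assoc]
  set z := y * (h.spinTorus t)⁻¹ with hz
  have hzact : vectorAction Q z = 1 := by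
    rw [hz, vectorAction_mul, hact, ← vectorAction_mul, mul_inv_cancel, vectorAction_one]
  -- The quotient `z` is even and acts trivially on V, hence is a scalar; being unitary it is ±1.
  -- The sign is absorbed by the torus, since -1 in a single coordinate gives the element -1.
  obtain ⟨s, hs⟩ := Algebra.mem_bot.1 (hb.mem_bot_of_commute (spinGroup.involute_eq z.2) fun w => by
    have := ι_vectorAction_mul z w
    rwa [hzact] at this)
  have hss : s * s = 1 := by
    have h1 := spinGroup.star_mul_self_of_mem z.2
    rw [← hs, star_algebraMap, ← map_mul] at h1
    exact (algebraMap k (CliffordAlgebra Q)).injective (h1.trans (map_one _).symm)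
  have hyz : y = z * h.spinTorus t := by rw [hz, inv_mul_cancel_right]
  rcases mul_self_eq_one_iff.1 hss with rfl | rfl
  · refine ⟨t, ?_⟩
    have : z = 1 := Subtype.ext (by rw [← hs, map_one]; rfl)
    rw [hyz, this, one_mul]
  · refine ⟨unitsOfCoords (Pi.mulSingle ⟨0, hn⟩ (-1)) * t, ?_⟩
    have : z = h.spinTorus (unitsOfCoords (Pi.mulSingle ⟨0, hn⟩ (-1))) := Subtype.ext (by
      rw [← hs, h.spinTorus_single]
      simp
      abel)
    rw [hyz, map_mul, this]

variable (S : Type*) [AddCommGroup S] [Module k S] [Module (even Q) S]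
  [IsScalarTower k (even Q) S]

/-- The parametrization of the torus of the half-spin group attached to a hyperbolic basis. -/
noncomputable def halfSpinTorus : (Fin n → k)ˣ →* (Module.End k S)ˣ :=
  (spinRepresentation Q S).comp h.spinTorus

theorem halfSpinTorus_range_le : (h.halfSpinTorus S).range ≤ halfSpinGroup Q S := by
  rintro _ ⟨t, rfl⟩
  exact ⟨_, rfl⟩

/-- The weights of a representation of the even Clifford algebra. -/
abbrev RepWeight : Type :=
  {ε : Fin n → Bool // Algebra.lsmul k k S (h.weightIdem ε) ≠ 0}

noncomputable instance : Fintype (h.RepWeight S) := Fintype.ofFinite _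

/-- The weight idempotents of a representation of the even Clifford algebra. -/
noncomputable def repIdem : h.RepWeight S → Module.End k S :=
  fun ε => Algebra.lsmul k k S (h.weightIdem ε)

/-- Some weight idempotents may act as zero on `S`, as happens for half of them in a half-spin
representation. Discarding them leaves nonzero idempotents, as the torus criterion requires. -/
theorem sum_repIdem (c : (Fin n → Bool) → k) :
    Algebra.lsmul k k S (∑ ε, c ε • h.weightIdem ε) = ∑ ε : h.RepWeight S, c ε.1 • h.repIdem S ε := by
  classical
  simp only [map_sum, map_smul, repIdem]
  rw [← Finset.sum_filter_of_ne (p := fun ε => Algebra.lsmul k k S (h.weightIdem ε) ≠ 0)]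
  · exact Finset.sum_subtype _ (fun ε => by simp) _
  · intro ε _ hε h0
    exact hε (by rw [h0, smul_zero])

theorem repIdem_complete : CompleteOrthogonalIdempotents (h.repIdem S) := by
  have hE := h.weightIdem_complete.map (Algebra.lsmul k k S : even Q →ₐ[k] Module.End k S).toRingHom
  refine ⟨⟨fun ε => hE.idem _, fun ε ε' hne => hE.ortho fun h => hne (Subtype.ext h)⟩, ?_⟩
  have h1 := h.sum_repIdem S fun _ => 1
  simp only [one_smul, h.weightIdem_complete.complete, map_one] at h1
  exact h1.symm

theorem halfSpinTorus_eq_diagonalHom :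
    h.halfSpinTorus S = diagonalHom (h.repIdem_complete S)
      fun ε : h.RepWeight S => monomialChar (spinWeight ε.1) := by
  refine MonoidHom.ext fun t => Units.ext ?_
  rw [diagonalHom_val, ← h.sum_repIdem S fun ε => (monomialChar (spinWeight ε) t : k)]
  rfl

theorem isTorus_range_halfSpinTorus [IsAlgClosed k] : IsTorus k (h.halfSpinTorus S).range := by
  rw [h.halfSpinTorus_eq_diagonalHom S]
  exact isTorus_range_diagonalHom (h.repIdem_complete S)
    (fun ε : h.RepWeight S => spinWeight ε.1) fun ε => ε.2

/-- The torus of the half-spin group attached to a hyperbolic basis has a character which is a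
weight of the half-spin representation. -/
theorem exists_weight [Nontrivial S] :
    ∃ (ε : Fin n → Bool) (x : CharacterLattice k (h.halfSpinTorus S).range),
      ∀ t, (x : Additive ((h.halfSpinTorus S).range →* kˣ)).toMul ⟨h.halfSpinTorus S t, t, rfl⟩ =
        monomialChar (spinWeight ε) t := by
  have : Nonempty (h.RepWeight S) := by
    by_contra hne
    rw [not_nonempty_iff] at hne
    have := (h.repIdem_complete S).complete
    rw [Finset.univ_eq_empty, Finset.sum_empty] at this
    exact zero_ne_one this
  obtain ⟨ε⟩ := this
  refine ⟨ε.1, ?_⟩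
  obtain ⟨x, hx⟩ := exists_character_diagonalHom (h.repIdem_complete S)
    (fun ε : h.RepWeight S => monomialChar (k := k) (spinWeight ε.1)) ε ε.2
  have hH := h.halfSpinTorus_eq_diagonalHom S
  generalize h.halfSpinTorus S = φ at hH ⊢
  subst hH
  exact ⟨x, hx⟩

end IsHyperbolicBasis

end HalfSpinTorus

/-! ### Every maximal torus comes from a hyperbolic basis -/

section MaximalTori

open CliffordAlgebra

variable {k V : Type*} [Field k] [CharZero k] [AddCommGroup V] [Module k V]
variable {Q : QuadraticForm k V}

omit [CharZero k] in
theorem spinRepresentation_val {S : Type*} [AddCommGroup S] [Module k S] [Module (even Q) S]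
    [IsScalarTower k (even Q) S] (x : spinGroup Q) :
    (spinRepresentation Q S x : Module.End k S) = Algebra.lsmul k k S (spinToEven x) := rfl

theorem exists_isHyperbolicBasis_vectorAction [IsAlgClosed k] [FiniteDimensional k V] {n : ℕ}
    (hV : Module.finrank k V = 2 * n) (hQ : Q.polarBilin.Nondegenerate) {m : ℕ} (hm : Odd m)
    (x : spinGroup Q) (hx : vectorAction Q x ^ m = 1) :
    ∃ (e f : Fin n → V) (c : Fin n → k), (∀ i, c i ≠ 0) ∧ IsHyperbolicBasis Q e f ∧
      (∀ i, vectorAction Q x (e i) = c i • e i) ∧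
      ∀ i, vectorAction Q x (f i) = (c i)⁻¹ • f i := by
  obtain ⟨e, f, c, hc, hee, hff, hef, hge, hgf, hexp⟩ := exists_hyperbolic_eigenbasis n hV
    Q.polarBilin (fun v w => QuadraticMap.polar_comm Q v w) hQ.1
    (vectorAction Q x) (polar_vectorAction x) hm hx
  exact ⟨e, f, c, hc, ⟨hee, hff, hef, hexp⟩, hge, hgf⟩

namespace IsHyperbolicBasis

variable {n : ℕ} {e f : Fin n → V} (h : IsHyperbolicBasis Q e f)

include h

theorem ι_e_ne_zero (i : Fin n) : ι Q (e i) ≠ 0 := by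
  intro h0
  have h1 : e i = 0 := ι_injective_of_charZero Q (h0.trans (map_zero _).symm)
  have h2 := h.ef i i
  rw [h1, if_pos rfl, QuadraticMap.polar_zero_left] at h2
  exact zero_ne_one h2

theorem e_mul_e_ne_zero {i j : Fin n} (hij : i ≠ j) : ι Q (e i) * ι Q (e j) ≠ 0 := by
  intro h0
  refine h.ι_e_ne_zero i ?_
  have h1 : ι Q (e i) * (ι Q (e j) * ι Q (f j) + ι Q (f j) * ι Q (e j)) = ι Q (e i) := by
    rw [h.f_mul_e, add_sub_cancel, mul_one]
  rw [← h1, mul_add, ← mul_assoc, h0, zero_mul, zero_add, ← mul_assoc, h.e_mul_f hij, neg_mul,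
    mul_assoc, h0, mul_zero, neg_zero]

theorem e_mul_f_ne_zero (i j : Fin n) : ι Q (e i) * ι Q (f j) ≠ 0 := by
  intro h0
  refine h.ι_e_ne_zero i ?_
  have h1 : ι Q (e i) * (ι Q (e j) * ι Q (f j) + ι Q (f j) * ι Q (e j)) = ι Q (e i) := by
    rw [h.f_mul_e, add_sub_cancel, mul_one]
  rw [← h1, mul_add, ← mul_assoc, ← mul_assoc, h0, zero_mul, add_zero, h.e_mul_e, neg_mul,
    mul_assoc, h0, mul_zero, neg_zero]

/-- An element of the spin group commuting with the even Clifford algebra acts on vectors by an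
involution. -/
theorem vectorAction_sq_eq_one {y : spinGroup Q} (hn : 1 < n)
    (hy : ∀ v w, spinToEven y * evenProd Q v w = evenProd Q v w * spinToEven y) :
    vectorAction Q (y ^ 2) = 1 := by
  choose a hae haf using fun i => h.exists_vectorAction_eq_smul (hy (e i) (f i))
  have hcancel : ∀ {a b : CliffordAlgebra Q}, a * y = b * y → a = b := by
    intro a b hab
    have := congrArg (· * ((y⁻¹ : spinGroup Q) : CliffordAlgebra Q)) hab
    simpa only [mul_assoc, spinGroup.coe_mul_inv, mul_one] using this
  have hvw : ∀ v w, ι Q (vectorAction Q y v) * ι Q (vectorAction Q y w) = ι Q v * ι Q w := by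
    intro v w
    have h1 := hy v w
    rw [spinToEven_conj_evenProd] at h1
    exact hcancel (congrArg Subtype.val h1)
  have hone : ∀ {c : k} {z : CliffordAlgebra Q}, z ≠ 0 → c • z = z → c = 1 := by
    intro c z hz hcz
    have : (c - 1) • z = 0 := by rw [sub_smul, hcz, one_smul, sub_self]
    exact sub_eq_zero.1 ((smul_eq_zero.1 this).resolve_right hz)
  -- Invariance of eᵢeⱼ gives aᵢaⱼ = 1 and that of eᵢfⱼ gives aᵢ = aⱼ, so aᵢ² = 1. A second index j
  -- exists because n > 1.
  have hsq : ∀ i, (a i : k) * a i = 1 := by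
    intro i
    obtain ⟨j, hij⟩ : ∃ j : Fin n, i ≠ j := by
      have : Nontrivial (Fin n) := Fin.nontrivial_iff_two_le.2 hn
      exact (exists_ne i).imp fun _ => Ne.symm
    have h1 := hvw (e i) (e j)
    have h2 := hvw (e i) (f j)
    rw [hae, hae, map_smul, map_smul, smul_mul_smul_comm] at h1
    rw [hae, haf, map_smul, map_smul, smul_mul_smul_comm] at h2
    have h1' := hone (h.e_mul_e_ne_zero hij) h1
    have h2' := hone (h.e_mul_f_ne_zero i j) h2
    rw [Units.mul_inv_eq_one] at h2'
    rwa [← h2'] at h1'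
  have hsq' : ∀ i, ((a i)⁻¹ : kˣ) * (a i)⁻¹ = 1 := fun i => by
    rw [← mul_inv, (Units.ext (hsq i) : a i * a i = 1), inv_one]
  refine h.vectorAction_ext (fun i => ?_) fun i => ?_
  · rw [pow_two, vectorAction_mul, Module.End.mul_apply, hae, map_smul, hae, smul_smul, hsq,
      one_smul, Module.End.one_apply]
  · rw [pow_two, vectorAction_mul, Module.End.mul_apply, haf, map_smul, haf, smul_smul,
      ← Units.val_mul, hsq', Units.val_one, one_smul, Module.End.one_apply]

theorem isMaximalTorus_eq_range [IsAlgClosed k] {S : Type*} [AddCommGroup S] [Module k S]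
    [Module (even Q) S] [IsScalarTower k (even Q) S] {T : Subgroup (Module.End k S)ˣ}
    (hT : IsMaximalTorus k (halfSpinGroup Q S) T) (hle : T ≤ (h.halfSpinTorus S).range) :
    T = (h.halfSpinTorus S).range :=
  le_antisymm hle (hT.2 ⟨h.halfSpinTorus_range_le S, h.isTorus_range_halfSpinTorus S⟩ hle)

end IsHyperbolicBasis

omit [CharZero k] in
theorem finiteDimensional_of_isSimpleModule_even [FiniteDimensional k (CliffordAlgebra Q)]
    (S : Type*) [AddCommGroup S] [Module k S] [Module (even Q) S] [IsScalarTower k (even Q) S]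
    [IsSimpleModule (even Q) S] : FiniteDimensional k S := by
  have : Module.Finite k (even Q) := FiniteDimensional.finiteDimensional_subalgebra (even Q)
  exact Module.Finite.trans (even Q) S

/-- Every maximal torus of the half-spin group is the torus attached to a hyperbolic basis. -/
theorem IsMaximalTorus.exists_eq_range_halfSpinTorus [IsAlgClosed k] {n : ℕ} (hn : 2 < n)
    (hV : Module.finrank k V = 2 * n) (hQ : Q.polarBilin.Nondegenerate)
    {S : Type*} [AddCommGroup S] [Module k S] [Module (even Q) S] [IsScalarTower k (even Q) S]
    [IsSimpleModule (even Q) S] {T : Subgroup (Module.End k S)ˣ}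
    (hT : IsMaximalTorus k (halfSpinGroup Q S) T) :
    ∃ (e f : Fin n → V) (h : IsHyperbolicBasis Q e f), T = (h.halfSpinTorus S).range := by
  have : FiniteDimensional k V := Module.finite_of_finrank_pos (by omega)
  obtain ⟨b, hb⟩ := exists_isOrthonormalGenerating Q hQ
  have hd : 4 < Module.finrank k V := by omega
  have := hb.finiteDimensional
  have := finiteDimensional_of_isSimpleModule_even (Q := Q) S
  have := IsSimpleModule.nontrivial (even Q) S
  obtain ⟨m, s, hm, hsT, hsm, hgen⟩ := hT.1.2.exists_odd_torsion_generator
  obtain ⟨x, hx⟩ := hT.1.1 hsT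
  -- The identity isometry merely supplies some hyperbolic basis, needed to see that the lift `x ^
  -- m` of 1 acts on V with square 1.
  obtain ⟨e₀, f₀, _, _, h₀, _, _⟩ := exists_isHyperbolicBasis_vectorAction (n := n) hV hQ odd_one
    (1 : spinGroup Q) (by rw [vectorAction_one, one_pow])
  have hκ : vectorAction Q ((x ^ m) ^ 2) = 1 := by
    refine h₀.vectorAction_sq_eq_one (by omega) fun v w => ?_
    refine spinToEven_commute_evenProd hb hd (Algebra.lsmul k k S) ?_
    rw [← spinRepresentation_val, map_pow, hx, hsm, Units.val_one, one_mul, mul_one]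
  -- The lift `x` itself may have even order on V; passing to x² removes the possible sign of `x ^
  -- m`. This is why T was put in the algebra generated by s² instead of s.
  obtain ⟨e, f, c, hc, h, hge, hgf⟩ := exists_isHyperbolicBasis_vectorAction (n := n) hV hQ hm
    (x ^ 2) (by rw [← vectorAction_pow, ← pow_mul, mul_comm, pow_mul, hκ])
  have hcomm : ∀ i, spinToEven (x ^ 2) * evenProd Q (e i) (f i) =
      evenProd Q (e i) (f i) * spinToEven (x ^ 2) := by
    intro i
    rw [spinToEven_conj_evenProd, hge, hgf]
    congr 1
    refine Subtype.ext ?_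
    rw [coe_evenProd, coe_evenProd, map_smul, map_smul, smul_mul_smul_comm, mul_inv_cancel₀ (hc i),
      one_smul]
  refine ⟨e, f, h, h.isMaximalTorus_eq_range hT fun t ht => ?_⟩
  obtain ⟨y, rfl⟩ := hT.1.1 ht
  obtain ⟨u, rfl⟩ := h.mem_range_spinTorus hb (by omega) (y := y) fun i => by
    refine spinToEven_commute_evenProd hb hd (Algebra.lsmul k k S) ?_
    -- The image of `y` is a polynomial in s² = π(x²), which commutes with π(eᵢfᵢ).
    have h1 : Commute (Algebra.lsmul k k S (evenProd Q (e i) (f i)))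
        (spinRepresentation Q S y : Module.End k S) := by
      refine Algebra.commute_of_mem_adjoin_of_forall_mem_commute (hgen _ ht) ?_
      rintro _ rfl
      have h2 := congrArg (Algebra.lsmul k k S : even Q →ₐ[k] Module.End k S) (hcomm i)
      rw [map_mul, map_mul, ← spinRepresentation_val, map_pow, hx, Units.val_pow_eq_pow_val] at h2
      exact h2.symm
    exact h1.eq.symm
  exact ⟨u, rfl⟩

end MaximalTori

/-! ### Sign changes of the coordinates realized in the spin group -/

section WeylElements

open CliffordAlgebra

section InvertOn

variable {k : Type*} [Field k] {n : ℕ}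

/-- The automorphism of `𝔾ₘⁿ` inverting the coordinates indexed by `s`. -/
noncomputable def invertOn (s : Finset (Fin n)) : (Fin n → k)ˣ →* (Fin n → k)ˣ :=
  (MulEquiv.piUnits.symm : (Fin n → kˣ) ≃* (Fin n → k)ˣ).toMonoidHom.comp
    (MonoidHom.pi fun i => if i ∈ s then (coordChar i)⁻¹ else coordChar i)

theorem coordChar_invertOn (s : Finset (Fin n)) (t : (Fin n → k)ˣ) (i : Fin n) :
    coordChar i (invertOn s t) = if i ∈ s then (coordChar i t)⁻¹ else coordChar i t := by
  change (if i ∈ s then (coordChar i)⁻¹ else coordChar i : (Fin n → k)ˣ →* kˣ) t = _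
  split_ifs <;> rfl

theorem coordChar_ext {t u : (Fin n → k)ˣ} (h : ∀ i, coordChar i t = coordChar i u) : t = u := by
  rw [← unitsOfCoords_coordChar t, ← unitsOfCoords_coordChar u]
  exact congrArg _ (funext h)

@[simp]
theorem invertOn_invertOn (s : Finset (Fin n)) (t : (Fin n → k)ˣ) :
    invertOn s (invertOn s t) = t :=
  coordChar_ext fun i => by
    simp only [coordChar_invertOn]
    split_ifs <;> simp

theorem invertOn_comm (s s' : Finset (Fin n)) (t : (Fin n → k)ˣ) :
    invertOn s (invertOn s' t) = invertOn s' (invertOn s t) :=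
  coordChar_ext fun i => by
    simp only [coordChar_invertOn]
    split_ifs <;> simp

/-- A coordinate lying in `s` or `s'` is inverted by exactly two of the three nontrivial elements of
the four-group, so its contributions cancel. -/
theorem mul_invertOn_of_cover {s s' : Finset (Fin n)} (h : ∀ i, i ∈ s ∨ i ∈ s')
    (t : (Fin n → k)ˣ) :
    t * invertOn s t * invertOn s' t * invertOn s (invertOn s' t) = 1 :=
  coordChar_ext fun i => by
    simp only [map_mul, coordChar_invertOn, map_one]
    rcases h i with h1 | h1 <;> simp only [h1, if_true] <;> split_ifs <;> simp

theorem invertOn_single_of_notMem {s : Finset (Fin n)} {i : Fin n} (hi : i ∉ s) (c : kˣ) :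
    invertOn s (unitsOfCoords (Pi.mulSingle i c)) = unitsOfCoords (Pi.mulSingle i c) :=
  coordChar_ext fun j => by
    rw [coordChar_invertOn, coordChar_unitsOfCoords]
    split_ifs with hj
    · rw [Pi.mulSingle_eq_of_ne (by rintro rfl; exact hi hj), inv_one]
    · rfl

theorem unitsOfCoords_single_inv (i : Fin n) (c : kˣ) :
    unitsOfCoords (Pi.mulSingle i c⁻¹) = (unitsOfCoords (Pi.mulSingle i c))⁻¹ :=
  coordChar_ext fun j => by
    rw [map_inv, coordChar_unitsOfCoords, coordChar_unitsOfCoords, Pi.mulSingle_inv, Pi.inv_apply]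

theorem unitsOfCoords_single_mul (i : Fin n) (c d : kˣ) :
    unitsOfCoords (Pi.mulSingle i (c * d)) =
      unitsOfCoords (Pi.mulSingle i c) * unitsOfCoords (Pi.mulSingle i d) :=
  coordChar_ext fun j => by
    rw [map_mul, coordChar_unitsOfCoords, coordChar_unitsOfCoords, coordChar_unitsOfCoords,
      Pi.mulSingle_mul, Pi.mul_apply]

theorem invertOn_single_of_mem {s : Finset (Fin n)} {i : Fin n} (hi : i ∈ s) (c : kˣ) :
    invertOn s (unitsOfCoords (Pi.mulSingle i c)) = (unitsOfCoords (Pi.mulSingle i c))⁻¹ :=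
  coordChar_ext fun j => by
    rw [coordChar_invertOn, map_inv, coordChar_unitsOfCoords]
    split_ifs with hj
    · rfl
    · rw [Pi.mulSingle_eq_of_ne (by rintro rfl; exact hj hi), inv_one]

end InvertOn

variable {k V : Type*} [Field k] [CharZero k] [AddCommGroup V] [Module k V]
variable {Q : QuadraticForm k V}

-- The star operation negates vectors, so a vector is unitary precisely when its square is -1.
omit [CharZero k] in
theorem ι_mem_pinGroup {v : V} (hv : ι Q v * ι Q v = -1) : ι Q v ∈ pinGroup Q := by
  have h1 : ι Q v * -ι Q v = 1 := by rw [mul_neg, hv, neg_neg]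
  have h2 : -ι Q v * ι Q v = 1 := by rw [neg_mul, hv, neg_neg]
  refine ⟨⟨⟨ι Q v, -ι Q v, h1, h2⟩, Subgroup.subset_closure ⟨v, rfl⟩, rfl⟩, ?_⟩
  change _ ∈ unitary _
  rw [Unitary.mem_iff, star_ι]
  exact ⟨h2, h1⟩

namespace IsHyperbolicBasis

variable {n : ℕ} {e f : Fin n → V} (h : IsHyperbolicBasis Q e f)

include h

/-- Up to a scalar, the vector eⱼ + fⱼ exchanges eⱼfⱼ with fⱼeⱼ = 1 - eⱼfⱼ and commutes with the
other eᵢfᵢ; multiply these vectors over `s`. The grade is the parity of the cardinality of `s`, so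
even sets land in the spin group. -/
theorem exists_pinGroup_swap [IsAlgClosed k] (s : Finset (Fin n)) :
    ∃ y ∈ pinGroup Q, y ∈ evenOdd Q (s.card : ZMod 2) ∧ ∀ i, y * (ι Q (e i) * ι Q (f i)) =
      (if i ∈ s then 1 - ι Q (e i) * ι Q (f i) else ι Q (e i) * ι Q (f i)) * y := by
  induction s using Finset.induction_on with
  | empty =>
    refine ⟨1, one_mem _, ?_, fun i => by simp⟩
    rw [Finset.card_empty, Nat.cast_zero]
    exact one_le_evenOdd_zero Q (Submodule.one_le.1 le_rfl)
  | insert j s hj ih =>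
    obtain ⟨y, hy, hys, hyc⟩ := ih
    -- The vector eⱼ + fⱼ has square 1; scaling by a square root of -1 gives the square -1 needed in
    -- the pin group.
    obtain ⟨z, hz⟩ := IsAlgClosed.exists_pow_nat_eq (-1 : k) (Nat.succ_pos 1)
    rw [Nat.succ_eq_add_one, one_add_one_eq_two] at hz
    have hr : ι Q (z • (e j + f j)) * ι Q (z • (e j + f j)) = -1 := by
      have := h.isUnit_e_add_f j 1
      rw [inv_one, Units.val_one, one_smul, one_smul] at this
      rw [map_smul, smul_mul_smul_comm, this, ← pow_two, hz, neg_smul, one_smul]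
    refine ⟨ι Q (z • (e j + f j)) * y, mul_mem (ι_mem_pinGroup hr) hy, ?_, fun i => ?_⟩
    · rw [Finset.card_insert_of_notMem hj, Nat.cast_add, Nat.cast_one, add_comm]
      exact SetLike.mul_mem_graded (ι_mem_evenOdd_one Q _) hys
    · rw [mul_assoc, hyc]
      by_cases hij : i = j
      · subst hij
        have hswap : ι Q (z • (e i + f i)) * (ι Q (e i) * ι Q (f i)) =
            (1 - ι Q (e i) * ι Q (f i)) * ι Q (z • (e i + f i)) := by
          rw [map_smul, smul_mul_assoc, mul_smul_comm, map_add, ← h.f_mul_e, add_mul, mul_add,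
            h.e_e_f, h.f_e_f, mul_assoc, h.e_sq, mul_zero, mul_assoc, h.f_e_f]
        rw [if_neg hj, if_pos (Finset.mem_insert_self i s), ← mul_assoc, hswap, mul_assoc]
      · have hc : Commute (ι Q (e i) * ι Q (f i)) (ι Q (z • (e j + f j))) := by
          rw [map_smul, map_add]
          exact ((h.commute_e hij).add_right (h.commute_f hij)).smul_right z
        have hmem : i ∈ insert j s ↔ i ∈ s := by simp [hij]
        rw [← mul_assoc, ← mul_assoc]
        congr 1
        simp only [hmem]
        split_ifs
        · exact (((Commute.one_left _).sub_left hc).eq).symm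
        · exact hc.eq.symm

/-- Even sets of sign changes of the coordinates are induced by elements of the spin group. -/
theorem exists_spinGroup_invertOn [IsAlgClosed k] {s : Finset (Fin n)} (hs : Even s.card) :
    ∃ y : spinGroup Q, ∀ t, y * h.spinTorus t = h.spinTorus (invertOn s t) * y := by
  obtain ⟨y, hy, hys, hyc⟩ := h.exists_pinGroup_swap s
  have hs0 : (s.card : ZMod 2) = 0 := (ZMod.natCast_eq_zero_iff_even).2 hs
  refine ⟨⟨y, hy, by rw [hs0] at hys; exact hys⟩, fun t => ?_⟩
  refine unitsOfCoords_induction (p := fun t => (⟨y, _⟩ : spinGroup Q) * h.spinTorus t =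
    h.spinTorus (invertOn s t) * ⟨y, _⟩) (by simp) (fun a b ha hb => ?_) (fun i c => ?_) t
  · rw [map_mul, ← mul_assoc, ha, mul_assoc, hb, ← mul_assoc, map_mul, map_mul]
  · refine Subtype.ext ?_
    rw [Submonoid.coe_mul, Submonoid.coe_mul, h.spinTorus_single]
    have h1 := hyc i
    by_cases hi : i ∈ s
    · rw [invertOn_single_of_mem hi, ← unitsOfCoords_single_inv, h.spinTorus_single]
      rw [if_pos hi] at h1
      simp only [mul_add, mul_sub, mul_smul_comm, add_mul, smul_mul_assoc, h1, mul_one, sub_mul,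
        one_mul, inv_inv, sub_sub_cancel]
      exact add_comm _ _
    · rw [invertOn_single_of_notMem hi, h.spinTorus_single]
      rw [if_neg hi] at h1
      simp only [mul_add, mul_sub, mul_smul_comm, add_mul, smul_mul_assoc, h1, mul_one, sub_mul,
        one_mul]

end IsHyperbolicBasis

end WeylElements

/-! ### Weyl group elements and their action on the torus -/

section WeylGroups

variable {A : Type*} [Ring A] {G T : Subgroup Aˣ}

theorem conjTorus_mul (g g' : torusNormalizer G T) (t : T) :
    conjTorus G T (g * g') t = conjTorus G T g (conjTorus G T g' t) :=
  Subtype.ext (by simp [conjTorus, mul_assoc])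

theorem conjTorus_one (t : T) : conjTorus G T 1 t = t :=
  Subtype.ext (by simp [conjTorus])

/-- An element of the Weyl group is determined by its action on the torus. -/
theorem WeylGroup.mk_eq_of_conjTorus {g g' : torusNormalizer G T}
    (h : ∀ t, conjTorus G T g t = conjTorus G T g' t) : (g : WeylGroup G T) = g' := by
  refine QuotientGroup.eq.2 (Subgroup.mem_subgroupOf.2 ⟨(g⁻¹ * g').2.1,
    Subgroup.mem_centralizer_iff.2 fun t ht => ?_⟩)
  have h1 : conjTorus G T (g⁻¹ * g') ⟨t, ht⟩ = ⟨t, ht⟩ := by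
    rw [conjTorus_mul, ← h, ← conjTorus_mul, inv_mul_cancel, conjTorus_one]
  exact (mul_inv_eq_iff_eq_mul.1 (congrArg Subtype.val h1)).symm

end WeylGroups

/-! ### The obstruction is nonzero for the half-spin group -/

section HalfSpinWeylGroup

open CliffordAlgebra

variable {k V : Type*} [Field k] [CharZero k] [AddCommGroup V] [Module k V]
variable {Q : QuadraticForm k V} {n : ℕ} {e f : Fin n → V}
variable (S : Type*) [AddCommGroup S] [Module k S] [Module (even Q) S]
  [IsScalarTower k (even Q) S]

namespace IsHyperbolicBasis

variable (h : IsHyperbolicBasis Q e f)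

/-- The value of a character of the half-spin torus at a point given by coordinates on a cover. -/
noncomputable def evalChar (χ : CharacterLattice k (h.halfSpinTorus S).range) :
    (Fin n → k)ˣ →* kˣ :=
  (χ : Additive ((h.halfSpinTorus S).range →* kˣ)).toMul.comp (h.halfSpinTorus S).rangeRestrict

theorem evalChar_add (χ ψ : CharacterLattice k (h.halfSpinTorus S).range) :
    h.evalChar S (χ + ψ) = h.evalChar S χ * h.evalChar S ψ := rfl

theorem evalChar_neg (χ : CharacterLattice k (h.halfSpinTorus S).range) :
    h.evalChar S (-χ) = (h.evalChar S χ)⁻¹ := rfl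

theorem evalChar_sub (χ ψ : CharacterLattice k (h.halfSpinTorus S).range) :
    h.evalChar S (χ - ψ) = h.evalChar S χ * (h.evalChar S ψ)⁻¹ := by
  rw [sub_eq_add_neg, evalChar_add, evalChar_neg]

theorem evalChar_zero : h.evalChar S 0 = 1 := rfl

theorem evalChar_injective : Function.Injective (h.evalChar S) := by
  intro χ ψ hχ
  refine Subtype.ext (Additive.toMul.injective (MonoidHom.ext ?_))
  rintro ⟨_, t, rfl⟩
  exact DFunLike.congr_fun hχ t

/-- Both points of the cover map to the element -1 of the spin group. In terms of exponents, all
exponents of a character have the same parity. -/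
theorem evalChar_single_neg_one (χ : CharacterLattice k (h.halfSpinTorus S).range) (i j : Fin n) :
    h.evalChar S χ (unitsOfCoords (Pi.mulSingle i (-1))) =
      h.evalChar S χ (unitsOfCoords (Pi.mulSingle j (-1))) := by
  have h1 : ∀ i, (h.spinTorus (unitsOfCoords (Pi.mulSingle i (-1))) : CliffordAlgebra Q) = -1 := by
    intro i
    rw [h.spinTorus_single]
    simp
    abel
  have h2 : h.spinTorus (unitsOfCoords (Pi.mulSingle i (-1))) =
      h.spinTorus (unitsOfCoords (Pi.mulSingle j (-1))) := Subtype.ext ((h1 i).trans (h1 j).symm)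
  have h3 : (h.halfSpinTorus S).rangeRestrict (unitsOfCoords (Pi.mulSingle i (-1))) =
      (h.halfSpinTorus S).rangeRestrict (unitsOfCoords (Pi.mulSingle j (-1))) :=
    Subtype.ext (congrArg (spinRepresentation Q S) h2)
  exact congrArg (χ : Additive ((h.halfSpinTorus S).range →* kˣ)).toMul h3

/-- Even sets of sign changes are induced by the normalizer of the half-spin torus. -/
theorem exists_torusNormalizer_invertOn [IsAlgClosed k] {s : Finset (Fin n)} (hs : Even s.card) :
    ∃ g : torusNormalizer (halfSpinGroup Q S) (h.halfSpinTorus S).range,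
      ∀ t, conjTorus _ _ g ((h.halfSpinTorus S).rangeRestrict t) =
        (h.halfSpinTorus S).rangeRestrict (invertOn s t) := by
  obtain ⟨y, hy⟩ := h.exists_spinGroup_invertOn hs
  have hconj : ∀ t, spinRepresentation Q S y * h.halfSpinTorus S t * (spinRepresentation Q S y)⁻¹ =
      h.halfSpinTorus S (invertOn s t) := by
    intro t
    rw [mul_inv_eq_iff_eq_mul]
    have := congrArg (spinRepresentation Q S) (hy t)
    rwa [map_mul, map_mul] at this
  refine ⟨⟨spinRepresentation Q S y, ⟨y, rfl⟩, ?_⟩, fun t => Subtype.ext (hconj t)⟩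
  refine Subgroup.mem_normalizer_iff.2 fun u => ⟨?_, ?_⟩
  · rintro ⟨t, rfl⟩
    exact ⟨invertOn s t, (hconj t).symm⟩
  · rintro ⟨t, ht⟩
    refine ⟨invertOn s t, ?_⟩
    have h1 := hconj (invertOn s t)
    rw [invertOn_invertOn, ht] at h1
    exact mul_left_cancel (mul_right_cancel h1)

/-- The Weyl group of the half-spin group contains commuting involutions acting by prescribed even
sets of sign changes. -/
theorem exists_weylGroup_pair [IsAlgClosed k] {s s' : Finset (Fin n)} (hs : Even s.card)
    (hs' : Even s'.card) :
    ∃ a b : WeylGroup (halfSpinGroup Q S) (h.halfSpinTorus S).range,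
      a * a = 1 ∧ b * b = 1 ∧ a * b = b * a ∧
      (∀ χ t, h.evalChar S (weylRepresentation k _ _ a χ) t = h.evalChar S χ (invertOn s t)) ∧
      ∀ χ t, h.evalChar S (weylRepresentation k _ _ b χ) t = h.evalChar S χ (invertOn s' t) := by
  obtain ⟨a, ha⟩ := h.exists_torusNormalizer_invertOn S hs
  obtain ⟨b, hb⟩ := h.exists_torusNormalizer_invertOn S hs'
  have hinv : ∀ {g : torusNormalizer (halfSpinGroup Q S) (h.halfSpinTorus S).range}
      {s : Finset (Fin n)}, (∀ t, conjTorus _ _ g ((h.halfSpinTorus S).rangeRestrict t) =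
        (h.halfSpinTorus S).rangeRestrict (invertOn s t)) → ∀ t,
      conjTorus _ _ g⁻¹ ((h.halfSpinTorus S).rangeRestrict t) =
        (h.halfSpinTorus S).rangeRestrict (invertOn s t) := by
    intro g s hg t
    rw [← invertOn_invertOn s t, ← hg, ← conjTorus_mul, inv_mul_cancel, conjTorus_one,
      invertOn_invertOn]
  refine ⟨a, b, ?_, ?_, ?_, fun χ t => ?_, fun χ t => ?_⟩
  · refine WeylGroup.mk_eq_of_conjTorus (g := a * a) (g' := 1) fun u => ?_
    obtain ⟨t, rfl⟩ := (h.halfSpinTorus S).rangeRestrict_surjective u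
    rw [conjTorus_mul, ha, ha, invertOn_invertOn, conjTorus_one]
  · refine WeylGroup.mk_eq_of_conjTorus (g := b * b) (g' := 1) fun u => ?_
    obtain ⟨t, rfl⟩ := (h.halfSpinTorus S).rangeRestrict_surjective u
    rw [conjTorus_mul, hb, hb, invertOn_invertOn, conjTorus_one]
  · refine WeylGroup.mk_eq_of_conjTorus (g := a * b) (g' := b * a) fun u => ?_
    obtain ⟨t, rfl⟩ := (h.halfSpinTorus S).rangeRestrict_surjective u
    rw [conjTorus_mul, conjTorus_mul, ha, hb, ha, hb, invertOn_comm]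
  · exact congrArg _ (hinv ha t)
  · exact congrArg _ (hinv hb t)

/-- The character lattice of the half-spin torus is not quasi-permutation, as the coordinates can
be divided into three nonempty sets whose pairwise unions are even. -/
theorem not_isQuasiPermutation [IsAlgClosed k] [Nontrivial S] {s s' : Finset (Fin n)}
    (hs : Even s.card) (hs' : Even s'.card) (hcover : ∀ i, i ∈ s ∨ i ∈ s') {p q r : Fin n}
    (hp : p ∉ s) (hq : q ∉ s') (hr : r ∈ s) (hr' : r ∈ s') :
    ¬ IsQuasiPermutation
      (weylRepresentation k (halfSpinGroup Q S) (h.halfSpinTorus S).range) := by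
  intro hquasi
  obtain ⟨ε, x, hx⟩ := h.exists_weight S
  replace hx : h.evalChar S x = monomialChar (spinWeight ε) := MonoidHom.ext hx
  obtain ⟨a, b, haa, hbb, hab, ha, hb⟩ := h.exists_weylGroup_pair S hs hs'
  obtain ⟨l, l', hl, hl', hll⟩ := hquasi.exists_antiinvariant_difference haa hbb hab x (by
    refine h.evalChar_injective S (MonoidHom.ext fun t => ?_)
    simp only [evalChar_add, evalChar_zero, MonoidHom.mul_apply, ha, hb]
    rw [← map_mul, ← map_mul, ← map_mul, invertOn_comm, mul_invertOn_of_cover hcover, map_one]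
    rfl)
  obtain ⟨z, hz⟩ := IsAlgClosed.exists_pow_nat_eq (-1 : k) (Nat.succ_pos 1)
  rw [Nat.succ_eq_add_one, one_add_one_eq_two, pow_two] at hz
  obtain ⟨c, hc⟩ : ∃ c : kˣ, c * c = -1 := by
    refine ⟨Units.mk0 z ?_, Units.ext hz⟩
    rintro rfl
    simp at hz
  -- At a coordinate `i` fixed by the sign change, an anti-invariant χ equals its own inverse, so
  -- its value at the square of the point with coordinate `c`, namely -1, is 1. This transfers to
  -- the coordinate `r`: the exponents of χ are even.
  have hone : ∀ {s : Finset (Fin n)} {χ : CharacterLattice k (h.halfSpinTorus S).range}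
      {i : Fin n}, i ∉ s → (∀ t, h.evalChar S χ (invertOn s t) = (h.evalChar S χ t)⁻¹) →
      h.evalChar S χ (unitsOfCoords (Pi.mulSingle r (-1))) = 1 := by
    intro s χ i hi hχ
    have h1 := hχ (unitsOfCoords (Pi.mulSingle i c))
    rw [invertOn_single_of_notMem hi, eq_inv_iff_mul_eq_one, ← map_mul,
      ← unitsOfCoords_single_mul, hc] at h1
    rwa [h.evalChar_single_neg_one S χ r i]
  have hl1 := hone hp (χ := l) fun t => by rw [← ha, hl, evalChar_neg, MonoidHom.inv_apply]
  have hl2 := hone hq (χ := l') fun t => by rw [← hb, hl', evalChar_neg, MonoidHom.inv_apply]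
  -- Evaluate at coordinate `r`, inverted by `a` and by `b` but fixed by `ab`. The side of `l` and
  -- `l'` is a product of their values (or inverse values) at -1, hence 1; the side of `x` is (-1)
  -- to the power ±1, hence -1.
  have h1 := DFunLike.congr_fun (congrArg (h.evalChar S) hll) (unitsOfCoords (Pi.mulSingle r c))
  simp only [evalChar_add, evalChar_sub, MonoidHom.mul_apply, MonoidHom.inv_apply, ha, hb,
    invertOn_single_of_mem hr, invertOn_single_of_mem hr', map_inv, inv_inv] at h1
  rw [← hc, unitsOfCoords_single_mul, map_mul] at hl1 hl2
  rw [hl1, one_mul, ← mul_inv, hl2, inv_one, hx, ← map_mul, ← unitsOfCoords_single_mul, hc,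
    monomialChar_apply, Finset.prod_eq_single r] at h1
  · rw [coordChar_unitsOfCoords, Pi.mulSingle_eq_same, spinWeight] at h1
    have h2 : (1 : k) = -1 := by
      have := congrArg Units.val h1
      split_ifs at this <;> simpa using this
    exact one_ne_zero (self_eq_neg.1 h2)
  · intro j _ hj
    rw [coordChar_unitsOfCoords, Pi.mulSingle_eq_of_ne hj, one_zpow]
  · simp

end IsHyperbolicBasis

end HalfSpinWeylGroup

theorem proposition5p2
    {k : Type*} [Field k] [IsAlgClosed k] [CharZero k]
    (n : ℕ) (hn : Even n) (hn4 : 4 < n)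
    {V : Type*} [AddCommGroup V] [Module k V] (hV : Module.finrank k V = 2 * n)
    (Q : QuadraticForm k V) (hQ : Q.polarBilin.Nondegenerate)
    {S : Type*} [AddCommGroup S] [Module k S] [Module (CliffordAlgebra.even Q) S]
    [IsScalarTower k (CliffordAlgebra.even Q) S] [IsSimpleModule (CliffordAlgebra.even Q) S]
    (T : Subgroup (Module.End k S)ˣ) (hT : IsMaximalTorus k (halfSpinGroup Q S) T) :
    ¬ IsQuasiPermutation (weylRepresentation k (halfSpinGroup Q S) T) := by
  obtain ⟨e, f, h, rfl⟩ := hT.exists_eq_range_halfSpinTorus (n := n) (by omega) hV hQ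
  have := IsSimpleModule.nontrivial (CliffordAlgebra.even Q) S
  -- Parity of n enters here: the complement of two coordinates is an even set.
  have hpair : ∀ i j : Fin n, i ≠ j → Even ((({i, j} : Finset (Fin n))ᶜ).card) := by
    intro i j hij
    rw [Finset.card_compl, Finset.card_pair hij, Fintype.card_fin]
    exact (Nat.even_sub (by omega)).2 (iff_of_true hn even_two)
  -- The blocks are {0, 1}, {2, 3} and the remaining coordinates; the last block contains 4 because
  -- n > 4. The two involutions invert the complements of the first and of the second block.
  refine h.not_isQuasiPermutation S
    (hpair ⟨0, by omega⟩ ⟨1, by omega⟩ (by simp)) (hpair ⟨2, by omega⟩ ⟨3, by omega⟩ (by simp))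
    (fun i => ?_) (p := ⟨0, by omega⟩) (q := ⟨2, by omega⟩) (r := ⟨4, by omega⟩)
    (by simp) (by simp) (by simp) (by simp)
  simp only [Finset.mem_compl, Finset.mem_insert, Finset.mem_singleton, Fin.ext_iff]
  omega
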